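/- For $\sigma\in\mathbb R$ let $\Omega_\sigma=\{s\in\mathbb C:\operatorname{Re}s>\sigma\}$, and let $\langle P_N\rangle$ be the set of positive integers all of whose prime factors are among the first $N$ primes. Let $w=(w_n)_{n\ge1}$ be a sequence of positive real numbers, and let $\sigma_0\in\mathbb R$ be such that $\sum_{n\ge 1} w_n^{-1}n^{-2\sigma}<\infty$ for every $\sigma>\sigma_0$. Let $\mathcal H^{\mathbf w}$ be the Hilbert space of Dirichlet series $\sum_{n\ge1} a_nn^{-s}$ with $\sum_n|a_n|^2w_n<\infty$, with inner product $\langle\sum a_nn^{-s},\sum b_nn^{-s}\rangle=\sum_n a_n\overline{b_n}w_n$; by the Cauchy–Schwarz inequality its elements converge absolutely on $\Omega_{\sigma_0}$. Let $\mathcal H^{\mathbf w}_N$ be the closed linear span of $\{n^{-s}:n\in\langle P_N\rangle\}$ in $\mathcal H^{\mathbf w}$, and $\pi_N$ the orthogonal projection of $\mathcal H^{\mathbf w}$ onto $\mathcal H^{\mathbf w}_N$. Let $\varphi$ be a multiplier of $\mathcal H^{\mathbf w}$, that is, a function on $\Omega_{\sigma_0}$ such that for every $f\in\mathcal H^{\mathbf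 w}$ the product $\varphi f$ on $\Omega_{\sigma_0}$ is (the sum of) an element of $\mathcal H^{\mathbf w}$. Then $\varphi$ is represented on $\Omega_{\sigma_0}$ by a unique element of $\mathcal H^{\mathbf w}$, again denoted by $\varphi$, and $M_\varphi f=\varphi f$ defines a (unique) bounded linear operator $M_\varphi$ on $\mathcal H^{\mathbf w}$; let $\|M_\varphi\|$ be its operator norm. Moreover: **Lower bound.** Let $0\le\Delta\le\Delta'$ be real numbers such that $\sum_{n\ge1}w_n^{-1}n^{-2\sigma'}<\infty$ for every $\sigma'>\Delta'$, and $\sum_{n\in\langle P_N\rangle}w_n^{-1}n^{-2\sigma}<\infty$ for every $N$ and every $\sigma>\Delta$. Then 1. every $f\in\mathcal H^{\mathbf w}$ converges absolutely on $\Omega_{\Delta'}$; 2. for every $N$, every $f\in\mathcal H^{\mathbf w}_N$ converges absolutely on $\Omega_\Delta$; 3. $\mathcal H^{\mathbf w}$ is a reproducing kernel Hilbert space of functions on $\Omega_{\Delta'}$: the map sending $f$ to its sum on $\Omega_{\Delta'}$ is injective and linear, and the evaluations $f\mapsto f(s)$, $s\in\Omega_{\Delta'}$, are continuous; 4. $\sup_{s\in\Omega_\Delta}|(\pi_N\varphi)(s)|\le\|M_\varphi\|$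 for every $N$; 5. the Dirichlet series of $\varphi$ converges at every point of $\Omega_\Delta$; its sum is analytic on $\Omega_\Delta$, agrees with $\varphi$ on $\Omega_\Delta\cap\Omega_{\sigma_0}$, and satisfies $\sup_{\Omega_\Delta}|\varphi|\le\|M_\varphi\|$. **Upper bound.** Let $\delta\ge0$. Suppose that $w$ is multiplicative ($w_1=1$ and $w_{mn}=w_mw_n$ for coprime $m,n$) and that $w_{p^k}\le p^{-2\delta}w_{p^{k-1}}$ for every prime $p$ and every integer $k\ge1$. Then $\|M_\varphi\|\le|\varphi|_{\Omega_\delta}$, where $|\varphi|_{\Omega_\delta}\in[0,\infty]$ is the supremum over $\Omega_\delta$ of the modulus of the analytic continuation of $\varphi$ to $\Omega_\delta$ (and $+\infty$ if there is no such continuation). -/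

import Mathlib

open Filter Topology
open scoped ENNReal

/-- The open right half-plane `Ω_σ = {s : Re s > σ}`. -/
def halfPlane (σ : ℝ) : Set ℂ := {s | σ < s.re}

/-- The weight condition at abscissa `σ₀`: `∑ wₙ⁻¹ n^(-2σ) < ∞` for every `σ > σ₀`.
(A sequence indexed by `n ≥ 1` is an `ArithmeticFunction`, i.e. it has the value `0` at `n = 0`, so
the index `0` contributes `0` to the sum.) -/
def WeightCondition (w : ArithmeticFunction ℝ) (σ₀ : ℝ) : Prop :=
  ∀ σ : ℝ, σ₀ < σ → Summable fun n : ℕ => (w n)⁻¹ * (n : ℝ) ^ (-2 * σ)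

/-- `⟨P_N⟩`: the positive integers all of whose prime factors are among the first `N` primes. -/
noncomputable def primeWords (N : ℕ) : Set ℕ :=
  Nat.factoredNumbers ((Finset.range N).image (Nat.nth Nat.Prime))

/-- The weight condition restricted to `⟨P_N⟩`, for every `N`. -/
def ProjectedWeightCondition (w : ArithmeticFunction ℝ) (Δ : ℝ) : Prop :=
  ∀ N : ℕ, ∀ σ : ℝ, Δ < σ →
    Summable fun n : primeWords N => (w (n : ℕ))⁻¹ * ((n : ℕ) : ℝ) ^ (-2 * σ)

/-- The series `∑ aₙ n^(-s)` converges (possibly only conditionally) at `s`, with sum `z`. -/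
def DirichletConvergesTo (a : ℕ → ℂ) (s z : ℂ) : Prop :=
  Tendsto (fun K : ℕ => ∑ n ∈ Finset.Icc 1 K, a n * (n : ℂ) ^ (-s)) atTop (𝓝 z)

/-- The supremum of `|F|` over `Ω_σ`, as an element of `[0, ∞]`. -/
noncomputable def supOnHalfPlane (F : ℂ → ℂ) (σ : ℝ) : ℝ≥0∞ :=
  ⨆ s ∈ halfPlane σ, ‖F s‖ₑ

section Space

variable (w : ArithmeticFunction ℝ) (hw : ∀ n : ℕ, n ≠ 0 → 0 < w n)

theorem weight_nonneg {w : ArithmeticFunction ℝ} (hw : ∀ n : ℕ, n ≠ 0 → 0 < w n) (n : ℕ) :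
    0 ≤ w n := by
  rcases eq_or_ne n 0 with rfl | h
  · simp
  · exact (hw n h).le

/-- The space of coefficient sequences `(aₙ)_{n ≥ 1}` with `∑ |aₙ|² wₙ < ∞`. -/
def coeffSubmodule : Submodule ℂ (ArithmeticFunction ℂ) where
  carrier := {a | Summable fun n : ℕ => ‖a n‖ ^ 2 * w n}
  zero_mem' := by simp [summable_zero]
  add_mem' := by
    intro a b ha hb
    refine Summable.of_nonneg_of_le (fun n => ?_) (fun n => ?_) ((ha.add hb).mul_left 2)
    · exact mul_nonneg (sq_nonneg _) (weight_nonneg hw n)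
    · have h0 := weight_nonneg hw n
      have h1 : ‖a n + b n‖ ^ 2 ≤ (‖a n‖ + ‖b n‖) ^ 2 := by
        gcongr
        exact norm_add_le _ _
      have h2 : ‖a n + b n‖ ^ 2 ≤ 2 * (‖a n‖ ^ 2 + ‖b n‖ ^ 2) := by
        nlinarith [sq_nonneg (‖a n‖ - ‖b n‖)]
      calc ‖(a + b) n‖ ^ 2 * w n ≤ (2 * (‖a n‖ ^ 2 + ‖b n‖ ^ 2)) * w n :=
            mul_le_mul_of_nonneg_right h2 h0
        _ = _ := by ring
  smul_mem' := by
    intro c a ha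
    have h := Summable.mul_left (‖c‖ ^ 2) ha
    refine h.congr fun n => ?_
    have : (c • a) n = c * a n := rfl
    rw [this, norm_mul]
    ring

/-- The space `𝓗^w` of Dirichlet series `∑ aₙ n^(-s)` with `∑ |aₙ|² wₙ < ∞`; an element is given by
its coefficient sequence. -/
def DirichletHilbert : Type := coeffSubmodule w hw

namespace DirichletHilbert

variable {w hw}

instance : AddCommGroup (DirichletHilbert w hw) :=
  inferInstanceAs (AddCommGroup (coeffSubmodule w hw))

instance : Module ℂ (DirichletHilbert w hw) :=
  inferInstanceAs (Module ℂ (coeffSubmodule w hw))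

/-- The coefficient sequence of an element of `𝓗^w`. -/
def coeff (f : DirichletHilbert w hw) : ArithmeticFunction ℂ := f.1

theorem coeff_summable (f : DirichletHilbert w hw) : Summable fun n : ℕ => ‖f.coeff n‖ ^ 2 * w n :=
  f.2

theorem coeff_ext {f g : DirichletHilbert w hw} (h : ∀ n, f.coeff n = g.coeff n) : f = g :=
  Subtype.ext (ArithmeticFunction.ext h)

theorem coeff_add (f g : DirichletHilbert w hw) (n : ℕ) :
    (f + g).coeff n = f.coeff n + g.coeff n := rfl

theorem coeff_smul (c : ℂ) (f : DirichletHilbert w hw) (n : ℕ) :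
    (c • f).coeff n = c * f.coeff n := rfl

/-- The square-summable sequence `√wₙ aₙ` attached to an element of `𝓗^w`. -/
noncomputable def toLp : DirichletHilbert w hw →ₗ[ℂ] lp (fun _ : ℕ => ℂ) 2 where
  toFun f := ⟨fun n => (Real.sqrt (w n) : ℂ) * f.coeff n, by
    refine memℓp_gen ?_
    refine f.coeff_summable.congr fun n => ?_
    rw [norm_mul, Complex.norm_real, Real.norm_of_nonneg (Real.sqrt_nonneg _)]
    simp only [ENNReal.toReal_ofNat, Real.rpow_two]
    rw [mul_pow, Real.sq_sqrt (weight_nonneg hw n)]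
    ring⟩
  map_add' f g := by
    ext n
    exact mul_add _ _ _
  map_smul' c f := by
    ext n
    simp [coeff_smul]
    ring

theorem toLp_apply (f : DirichletHilbert w hw) (n : ℕ) :
    toLp f n = (Real.sqrt (w n) : ℂ) * f.coeff n := rfl

theorem toLp_injective : Function.Injective (toLp (w := w) (hw := hw)) := by
  intro f g h
  refine coeff_ext fun n => ?_
  rcases eq_or_ne n 0 with rfl | hn
  · simp
  · have h1 : toLp f n = toLp g n := by rw [h]
    rw [toLp_apply, toLp_apply] at h1
    have h2 : (Real.sqrt (w n) : ℂ) ≠ 0 :=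
      Complex.ofReal_ne_zero.mpr (Real.sqrt_pos.mpr (hw n hn)).ne'
    exact mul_left_cancel₀ h2 h1

/-- The inner product `∑ aₙ conj(bₙ) wₙ` of `𝓗^w`; by Mathlib's convention it is conjugate-linear in
the first argument. -/
noncomputable def innerSum (f g : DirichletHilbert w hw) : ℂ :=
  ∑' n : ℕ, (starRingEnd ℂ) (f.coeff n) * g.coeff n * (w n : ℂ)

theorem innerSum_eq (f g : DirichletHilbert w hw) :
    innerSum f g = inner ℂ (toLp f) (toLp g) := by
  rw [innerSum, lp.inner_eq_tsum]
  refine tsum_congr fun n => ?_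
  have h : ((Real.sqrt (w n) : ℝ) : ℂ) * (Real.sqrt (w n) : ℝ) = (w n : ℂ) := by
    rw [← Complex.ofReal_mul, Real.mul_self_sqrt (weight_nonneg hw n)]
  rw [toLp_apply, toLp_apply, RCLike.inner_apply, map_mul, Complex.conj_ofReal, ← h]
  ring

/-- The inner product space axioms for `𝓗^w`. -/
@[reducible]
noncomputable def core : InnerProductSpace.Core ℂ (DirichletHilbert w hw) where
  inner f g := innerSum f g
  conj_inner_symm f g := by
    rw [innerSum_eq, innerSum_eq, inner_conj_symm]
  re_inner_nonneg f := by
    rw [innerSum_eq]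
    exact inner_self_nonneg
  add_left f g h := by
    rw [innerSum_eq, innerSum_eq, innerSum_eq, map_add, inner_add_left]
  smul_left f g c := by
    rw [innerSum_eq, innerSum_eq, map_smul, inner_smul_left]
  definite f hf := by
    rw [innerSum_eq, inner_self_eq_zero] at hf
    exact toLp_injective (by rw [hf, map_zero])

noncomputable instance : NormedAddCommGroup (DirichletHilbert w hw) :=
  core.toNormedAddCommGroup

noncomputable instance : InnerProductSpace ℂ (DirichletHilbert w hw) :=
  InnerProductSpace.ofCore core.toCore

theorem inner_def (f g : DirichletHilbert w hw) :
    inner ℂ f g = ∑' n : ℕ, (starRingEnd ℂ) (f.coeff n) * g.coeff n * (w n : ℂ) := rfl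

theorem norm_toLp (f : DirichletHilbert w hw) : ‖toLp f‖ = ‖f‖ := by
  rw [norm_eq_sqrt_re_inner (𝕜 := ℂ) f, norm_eq_sqrt_re_inner (𝕜 := ℂ) (toLp f), ← innerSum_eq]
  rfl

theorem range_toLp :
    Set.range (toLp (w := w) (hw := hw)) = {x : lp (fun _ : ℕ => ℂ) 2 | x 0 = 0} := by
  ext x
  constructor
  · rintro ⟨f, rfl⟩
    simp [toLp_apply]
  · intro hx
    have hx0 : x 0 = 0 := hx
    have key : ∀ n : ℕ, (Real.sqrt (w n) : ℂ) * ((Real.sqrt (w n) : ℂ)⁻¹ * x n) = x n := by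
      intro n
      rcases eq_or_ne n 0 with rfl | hn
      · simp [hx0]
      · have h2 : (Real.sqrt (w n) : ℂ) ≠ 0 :=
          Complex.ofReal_ne_zero.mpr (Real.sqrt_pos.mpr (hw n hn)).ne'
        rw [mul_inv_cancel_left₀ h2]
    let a : ArithmeticFunction ℂ := ⟨fun n => (Real.sqrt (w n) : ℂ)⁻¹ * x n, by simp [hx0]⟩
    have ha : a ∈ coeffSubmodule w hw := by
      have hs : Summable fun n : ℕ => ‖x n‖ ^ 2 := by
        have := (lp.memℓp x).summable (by norm_num)
        simpa using this
      refine hs.congr fun n => ?_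
      rw [← key n, norm_mul, Complex.norm_real, Real.norm_of_nonneg (Real.sqrt_nonneg _), mul_pow,
        Real.sq_sqrt (weight_nonneg hw n), mul_comm]
      rfl
    refine ⟨(⟨a, ha⟩ : coeffSubmodule w hw), ?_⟩
    ext n
    exact key n

instance : CompleteSpace (DirichletHilbert w hw) := by
  let T : DirichletHilbert w hw →ₗᵢ[ℂ] lp (fun _ : ℕ => ℂ) 2 := ⟨toLp, norm_toLp⟩
  have hc : IsClosed (Set.range T) := by
    have h : Set.range T = {x : lp (fun _ : ℕ => ℂ) 2 | x 0 = 0} := range_toLp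
    rw [h]
    have hcont : Continuous fun x : lp (fun _ : ℕ => ℂ) 2 => x 0 :=
      (lp.evalCLM ℂ (fun _ : ℕ => ℂ) 2 0).continuous
    exact isClosed_eq hcont continuous_const
  exact (completeSpace_iff_isComplete_range T.isometry.isUniformInducing).mpr hc.isComplete

end DirichletHilbert

end Space

section Multipliers

variable {w : ArithmeticFunction ℝ} {hw : ∀ n : ℕ, n ≠ 0 → 0 < w n}

/-- The function `s ↦ ∑ aₙ n^(-s)` defined by an element of `𝓗^w`, wherever the series converges
absolutely. -/
noncomputable def DirichletHilbert.eval (f : DirichletHilbert w hw) (s : ℂ) : ℂ :=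
  LSeries f.coeff s

/-- The series of `f` converges absolutely at every point of `Ω_σ`. -/
def DirichletHilbert.AbsConvergesOn (f : DirichletHilbert w hw) (σ : ℝ) : Prop :=
  ∀ s ∈ halfPlane σ, LSeriesSummable f.coeff s

/-- `f` is the Dirichlet series of the function `φ` on `Ω_{σ₀}`. -/
def DirichletHilbert.Represents (f : DirichletHilbert w hw) (φ : ℂ → ℂ) (σ₀ : ℝ) : Prop :=
  ∀ s ∈ halfPlane σ₀, LSeriesHasSum f.coeff s (φ s)

variable (w hw) in
/-- `φ`, a function on `Ω_{σ₀}` (its values elsewhere play no role), is a multiplier of `𝓗^w`: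
the product `φ f` on `Ω_{σ₀}` belongs to `𝓗^w` for every `f ∈ 𝓗^w`. -/
def IsMultiplier (φ : ℂ → ℂ) (σ₀ : ℝ) : Prop :=
  ∀ f : DirichletHilbert w hw, ∃ g : DirichletHilbert w hw,
    g.Represents (fun s => φ s * f.eval s) σ₀

/-- `M` is the operator `M_φ` of multiplication by `φ` on `𝓗^w`. -/
def IsMultiplicationOperator (φ : ℂ → ℂ) (σ₀ : ℝ)
    (M : DirichletHilbert w hw →L[ℂ] DirichletHilbert w hw) : Prop :=
  ∀ f : DirichletHilbert w hw, (M f).Represents (fun s => φ s * f.eval s) σ₀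

/-- `ψ` is the analytic continuation to `Ω_σ` of the function `φ` on `Ω_{σ₀}`. -/
def IsAnalyticContinuation (φ : ℂ → ℂ) (σ₀ : ℝ) (ψ : ℂ → ℂ) (σ : ℝ) : Prop :=
  DifferentiableOn ℂ ψ (halfPlane σ) ∧ ∀ s ∈ halfPlane σ ∩ halfPlane σ₀, ψ s = φ s

variable (w hw) in
/-- `𝓗^w_N`: the closed span in `𝓗^w` of the functions `n^(-s)`, `n ∈ ⟨P_N⟩`. -/
noncomputable def projSubspace (N : ℕ) : Submodule ℂ (DirichletHilbert w hw) :=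
  (Submodule.span ℂ {f : DirichletHilbert w hw |
    ∃ n ∈ primeWords N, ∀ m : ℕ, f.coeff m = if m = n then 1 else 0}).topologicalClosure

noncomputable instance (N : ℕ) : CompleteSpace (projSubspace w hw N) :=
  inferInstanceAs (CompleteSpace (Submodule.topologicalClosure _))

variable (w hw) in
/-- `π_N`: the orthogonal projection of `𝓗^w` onto `𝓗^w_N`. -/
noncomputable def proj (N : ℕ) : DirichletHilbert w hw →L[ℂ] DirichletHilbert w hw :=
  (projSubspace w hw N).starProjection

end Multipliers

/-! By uniqueness of coefficients, multiplication by `φ` is Dirichlet convolution with the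
coefficients of `φ`, and `π_N` restricts coefficients to `⟨P_N⟩`.

Lower bound. Since `⟨P_N⟩` is closed under products and divisors, the compression of `M_φ` to
`𝓗^w_N` is multiplication by `π_N φ`. Evaluation at `s ∈ Ω_Δ` is a nonzero bounded functional on
`𝓗^w_N` and an eigenvector of the transpose of this compression with eigenvalue `(π_N φ)(s)`, so
this number is at most `‖M_φ‖` (`norm_eval_proj_le`). To let `N → ∞`, Bohr's inequality
(`exists_norm_partialSum_le`) bounds the `K`-th partial sums of all `π_N φ` by a constant times
`(K+1)^ε`, uniformly in `N`. Each partial sum of `φ` is one of `π_N φ` for large `N`, so the same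
growth holds for `φ`. Summation by parts then gives convergence, analyticity and the bound
(`exists_bounded_sum_of_eventually_eq`).

Upper bound. Let `|φ| ≤ C` on `Ω_δ`. Means along vertical lines recover Dirichlet coefficients even
to the left of absolute convergence, because Cauchy's theorem moves the line. Comparing means of `φ
f` and `f` for Dirichlet polynomials over the divisors of `J` shows that convolution with `φ` has
norm at most `C` for the weight `n^(-2δ)` on those divisors (`sum_divisors_norm_mul_sq_le`). The
hypotheses on `w` make `w n * n^(2δ)`, on the divisors of `J`, a nonnegative combination of the
indicators of `n ∣ d` with `d ∣ J` (`exists_sum_divisors_eq`). Adding the inequalities for these `d`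
gives the weight `w`, and `J = K!` exhausts all indices. -/

namespace DirichletHilbert

variable {w : ArithmeticFunction ℝ} {hw : ∀ n : ℕ, n ≠ 0 → 0 < w n}

/-! ### Coefficient functionals, Cauchy–Schwarz and point evaluations. -/

theorem inner_self_eq (f : DirichletHilbert w hw) :
    inner ℂ f f = ((∑' n : ℕ, ‖f.coeff n‖ ^ 2 * w n : ℝ) : ℂ) := by
  rw [inner_def, Complex.ofReal_tsum]
  refine tsum_congr fun n => ?_
  rw [← Complex.normSq_eq_conj_mul_self, Complex.normSq_eq_norm_sq]
  push_cast
  ring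

theorem norm_sq_eq (f : DirichletHilbert w hw) :
    ‖f‖ ^ 2 = ∑' n : ℕ, ‖f.coeff n‖ ^ 2 * w n := by
  rw [← inner_self_eq_norm_sq (𝕜 := ℂ), inner_self_eq]
  simp

theorem norm_coeff_sq_le (f : DirichletHilbert w hw) (n : ℕ) :
    ‖f.coeff n‖ ^ 2 * w n ≤ ‖f‖ ^ 2 := by
  rw [norm_sq_eq]
  exact f.coeff_summable.le_tsum n fun m _ => mul_nonneg (sq_nonneg _) (weight_nonneg hw m)

/-- The coefficient functional `f ↦ aₙ`. -/
noncomputable def coeffCLM (n : ℕ) : DirichletHilbert w hw →L[ℂ] ℂ :=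
  LinearMap.mkContinuous
    { toFun := fun f => f.coeff n
      map_add' := fun f g => coeff_add f g n
      map_smul' := fun c f => coeff_smul c f n } (Real.sqrt (w n))⁻¹ (by
    intro f
    -- At `n = 0` the constant is `0⁻¹ = 0`, which suffices because the coefficient there vanishes.
    rcases eq_or_ne n 0 with rfl | hn
    · simp
    · have hs : 0 < Real.sqrt (w n) := Real.sqrt_pos.mpr (hw n hn)
      rw [inv_mul_eq_div, le_div_iff₀ hs]
      refine le_of_sq_le_sq ?_ (norm_nonneg _)
      rw [mul_pow, Real.sq_sqrt (weight_nonneg hw n)]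
      exact norm_coeff_sq_le f n)

@[simp]
theorem coeffCLM_apply (n : ℕ) (f : DirichletHilbert w hw) : coeffCLM n f = f.coeff n := rfl

theorem continuous_coeff (n : ℕ) : Continuous fun f : DirichletHilbert w hw => f.coeff n :=
  (coeffCLM n).continuous

theorem coeff_sub (f g : DirichletHilbert w hw) (n : ℕ) :
    (f - g).coeff n = f.coeff n - g.coeff n :=
  map_sub (coeffCLM (w := w) (hw := hw) n) f g

/-- The restriction of a Dirichlet series to the indices in a set. -/
noncomputable def restrict (S : Set ℕ) (f : DirichletHilbert w hw) : DirichletHilbert w hw :=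
  (⟨⟨S.indicator f.coeff, by simp⟩, by
    refine Summable.of_nonneg_of_le
      (fun n => mul_nonneg (sq_nonneg _) (weight_nonneg hw n)) (fun n => ?_) f.coeff_summable
    have := weight_nonneg hw n
    change ‖S.indicator f.coeff n‖ ^ 2 * w n ≤ _
    gcongr
    exact norm_indicator_le_norm_self _ _⟩ : coeffSubmodule w hw)

theorem coeff_restrict (S : Set ℕ) (f : DirichletHilbert w hw) (n : ℕ) :
    (restrict S f).coeff n = S.indicator f.coeff n := rfl

variable (w hw) in
/-- The Dirichlet monomial `n^(-s)` (it is `0` for `n = 0`). -/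
noncomputable def monomial (n : ℕ) : DirichletHilbert w hw :=
  (⟨⟨fun m => if m = n ∧ m ≠ 0 then 1 else 0, by simp⟩, by
    refine summable_of_ne_finset_zero (s := {n}) fun m hm => ?_
    have : m ≠ n := by simpa using hm
    change ‖(if m = n ∧ m ≠ 0 then 1 else 0 : ℂ)‖ ^ 2 * w m = 0
    simp [this]⟩ : coeffSubmodule w hw)

theorem coeff_monomial {n : ℕ} (hn : n ≠ 0) (m : ℕ) :
    (monomial w hw n).coeff m = if m = n then 1 else 0 := by
  change (if m = n ∧ m ≠ 0 then 1 else 0 : ℂ) = _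
  by_cases h : m = n
  · simp [h, hn]
  · simp [h]

theorem coeff_monomial_one : (monomial w hw 1).coeff = 1 := by
  ext m
  rw [coeff_monomial one_ne_zero, ArithmeticFunction.one_apply]

theorem inner_monomial_left {n : ℕ} (hn : n ≠ 0) (f : DirichletHilbert w hw) :
    inner ℂ (monomial w hw n) f = f.coeff n * (w n : ℂ) := by
  rw [inner_def, tsum_eq_single n]
  · simp [coeff_monomial hn]
  · intro m hm
    simp [coeff_monomial hn, hm]

/-- Cauchy–Schwarz for a Dirichlet series whose coefficients vanish off `S`. -/
theorem tsum_norm_term_le {S : Set ℕ} {s : ℂ}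
    (hS : Summable fun n : S => (w (n : ℕ))⁻¹ * ((n : ℕ) : ℝ) ^ (-2 * s.re))
    {f : DirichletHilbert w hw} (hf : ∀ n ∉ S, f.coeff n = 0) :
    LSeriesSummable f.coeff s ∧ ‖f.eval s‖ ≤
      Real.sqrt (∑' n : S, (w (n : ℕ))⁻¹ * ((n : ℕ) : ℝ) ^ (-2 * s.re)) * ‖f‖ := by
  set b : ℕ → ℝ := S.indicator fun n => (w n)⁻¹ * (n : ℝ) ^ (-2 * s.re) with hb
  have hbs : Summable b := summable_subtype_iff_indicator.mp hS
  have hb0 : ∀ n, 0 ≤ b n := fun n => Set.indicator_nonneg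
    (fun m _ => mul_nonneg (inv_nonneg.mpr (weight_nonneg hw m)) (by positivity)) n
  have hbt : ∑' n : S, (w (n : ℕ))⁻¹ * ((n : ℕ) : ℝ) ^ (-2 * s.re) = ∑' n, b n :=
    tsum_subtype S fun n => (w n)⁻¹ * (n : ℝ) ^ (-2 * s.re)
  -- The term splits into `|aₙ| √wₙ` and `n^(-Re s) / √wₙ`, both square-summable on `S`.
  have hterm : ∀ n, ‖LSeries.term f.coeff s n‖ =
      (‖f.coeff n‖ * Real.sqrt (w n)) * Real.sqrt (b n) := by
    intro n
    rcases eq_or_ne n 0 with rfl | hn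
    · simp
    by_cases hnS : n ∈ S
    · have hn0 : (0 : ℝ) < n := by positivity
      have hs : 0 < Real.sqrt (w n) := Real.sqrt_pos.mpr (hw n hn)
      have h1 : Real.sqrt (b n) = (Real.sqrt (w n))⁻¹ * (n : ℝ) ^ (-s.re) := by
        rw [hb, Set.indicator_of_mem hnS, Real.sqrt_mul (inv_nonneg.mpr (weight_nonneg hw n)),
          Real.sqrt_inv, show -2 * s.re = (-s.re) * (2 : ℕ) by push_cast; ring,
          Real.rpow_mul hn0.le, Real.rpow_natCast, Real.sqrt_sq (by positivity)]
      rw [h1, LSeries.norm_term_eq, if_neg hn, Real.rpow_neg hn0.le]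
      field_simp
    · simp [hn, hf n hnS]
  have hp : (2 : ℝ).HolderConjugate 2 := Real.HolderConjugate.two_two
  have hA : ∀ n, (‖f.coeff n‖ * Real.sqrt (w n)) ^ (2 : ℝ) = ‖f.coeff n‖ ^ 2 * w n := fun n => by
    rw [Real.rpow_two, mul_pow, Real.sq_sqrt (weight_nonneg hw n)]
  have hB : ∀ n, (Real.sqrt (b n)) ^ (2 : ℝ) = b n := fun n => by
    rw [Real.rpow_two, Real.sq_sqrt (hb0 n)]
  have key := Real.summable_and_inner_le_Lp_mul_Lq_tsum_of_nonneg hp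
    (f := fun n => ‖f.coeff n‖ * Real.sqrt (w n)) (g := fun n => Real.sqrt (b n))
    (fun n => by positivity) (fun n => by positivity)
    (by simpa only [hA] using f.coeff_summable) (by simpa only [hB] using hbs)
  have hsum : Summable fun n => ‖LSeries.term f.coeff s n‖ := by
    simpa only [hterm] using key.1
  refine ⟨hsum.of_norm, (norm_tsum_le_tsum_norm hsum).trans ?_⟩
  simp only [hterm]
  refine key.2.trans_eq ?_
  simp only [hA, hB]
  rw [← norm_sq_eq, hbt, ← Real.sqrt_eq_rpow, ← Real.sqrt_eq_rpow, Real.sqrt_sq (norm_nonneg _),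
    mul_comm]

theorem absConvergesOn {σ : ℝ} (h : WeightCondition w σ) (f : DirichletHilbert w hw) :
    f.AbsConvergesOn σ := fun s hs =>
  (tsum_norm_term_le (S := Set.univ) ((h s.re hs).subtype _) (by simp)).1

theorem eval_add {f g : DirichletHilbert w hw} {s : ℂ} (hf : LSeriesSummable f.coeff s)
    (hg : LSeriesSummable g.coeff s) : (f + g).eval s = f.eval s + g.eval s :=
  LSeries_add hf hg

theorem eval_smul (c : ℂ) (f : DirichletHilbert w hw) (s : ℂ) :
    (c • f).eval s = c * f.eval s :=
  LSeries_smul f.coeff c s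

theorem abscissa_lt_top {σ : ℝ} (h : WeightCondition w σ) (f : DirichletHilbert w hw) :
    LSeries.abscissaOfAbsConv f.coeff < ⊤ := by
  refine (LSeriesSummable.abscissaOfAbsConv_le
    (absConvergesOn h f ((σ + 1 : ℝ) : ℂ) ?_)).trans_lt (EReal.coe_lt_top _)
  simp [halfPlane]

/-- Agreement at all large real points already determines the coefficients of a Dirichlet series. -/
theorem coeff_eq_of_eval_eq {σ : ℝ} (h : WeightCondition w σ) (f : DirichletHilbert w hw)
    {a : ArithmeticFunction ℂ} (ha : LSeries.abscissaOfAbsConv a < ⊤)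
    (hfa : ∀ s ∈ halfPlane σ, f.eval s = LSeries a s) : f.coeff = a := by
  ext n
  rcases eq_or_ne n 0 with rfl | hn
  · simp
  refine LSeries.eq_of_LSeries_eventually_eq (abscissa_lt_top h f) ha ?_ hn
  filter_upwards [eventually_gt_atTop σ] with x hx
  exact hfa x (by simpa [halfPlane] using hx)

theorem eval_injOn {σ : ℝ} (h : WeightCondition w σ) {f g : DirichletHilbert w hw}
    (hfg : ∀ s ∈ halfPlane σ, f.eval s = g.eval s) : f = g := by
  have := coeff_eq_of_eval_eq h f (abscissa_lt_top h g) hfg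
  exact coeff_ext fun n => by rw [this]

/-- Point evaluation on `𝓗^w`. -/
noncomputable def evalCLM {σ : ℝ} (h : WeightCondition w σ) (s : halfPlane σ) :
    DirichletHilbert w hw →L[ℂ] ℂ :=
  LinearMap.mkContinuous
    { toFun := fun f => f.eval s
      map_add' := fun f g => eval_add (absConvergesOn h f s s.2) (absConvergesOn h g s s.2)
      map_smul' := fun c f => eval_smul c f s } _ fun f =>
    (tsum_norm_term_le (S := Set.univ) ((h (s : ℂ).re s.2).subtype _) (by simp)).2

/-- `𝓗^w` as a reproducing kernel Hilbert space on `Ω_σ`. -/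
@[reducible]
noncomputable def rkhs {σ : ℝ} (h : WeightCondition w σ) :
    RKHS ℂ (DirichletHilbert w hw) (halfPlane σ) ℂ where
  coeCLM := ContinuousLinearMap.pi fun s => evalCLM h s
  coeCLM_injective := by
    intro f g hfg
    refine eval_injOn h fun s hs => ?_
    exact congrFun hfg ⟨s, hs⟩

/-! ### The subspaces `𝓗^w_N` and their projections. -/

section Projection

theorem primeWords_ne_zero {N n : ℕ} (hn : n ∈ primeWords N) : n ≠ 0 :=
  Nat.ne_zero_of_mem_factoredNumbers hn

/-- Coefficient functionals are continuous, so vanishing off `⟨P_N⟩` passes to the closure.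
Conversely the closure is the double orthogonal complement, and a vector orthogonal to the monomials
has no coefficients on `⟨P_N⟩`. -/
theorem mem_projSubspace_iff {N : ℕ} {f : DirichletHilbert w hw} :
    f ∈ projSubspace w hw N ↔ ∀ n ∉ primeWords N, f.coeff n = 0 := by
  constructor
  · intro hf n hn
    have hle : projSubspace w hw N ≤ LinearMap.ker (coeffCLM (w := w) (hw := hw) n).toLinearMap := by
      refine Submodule.topologicalClosure_minimal _ (Submodule.span_le.mpr ?_)
        (coeffCLM (w := w) (hw := hw) n).isClosed_ker
      rintro g ⟨m, hm, hg⟩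
      have : n ≠ m := fun h => hn (h ▸ hm)
      simp [hg, this]
    exact hle hf
  · intro hf
    rw [projSubspace, ← Submodule.orthogonal_orthogonal_eq_closure, Submodule.mem_orthogonal]
    intro g hg
    rw [inner_def]
    refine (tsum_congr fun n => ?_).trans tsum_zero
    by_cases hn : n ∈ primeWords N
    · have hn0 := primeWords_ne_zero hn
      have h1 : inner ℂ (monomial w hw n) g = 0 :=
        (Submodule.mem_orthogonal _ _).mp hg _
          (Submodule.subset_span ⟨n, hn, coeff_monomial hn0⟩)
      rw [inner_monomial_left hn0] at h1
      have h2 : g.coeff n = 0 :=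
        (mul_eq_zero.mp h1).resolve_right (Complex.ofReal_ne_zero.mpr (hw n hn0).ne')
      simp [h2]
    · simp [hf n hn]

theorem proj_eq_restrict (N : ℕ) (f : DirichletHilbert w hw) :
    proj w hw N f = restrict (primeWords N) f := by
  refine Submodule.eq_starProjection_of_mem_of_inner_eq_zero ?_ fun g hg => ?_
  · exact mem_projSubspace_iff.mpr fun n hn => by rw [coeff_restrict, Set.indicator_of_notMem hn]
  · rw [inner_def]
    refine (tsum_congr fun n => ?_).trans tsum_zero
    rw [coeff_sub, coeff_restrict]
    by_cases hn : n ∈ primeWords N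
    · simp [hn]
    · simp [mem_projSubspace_iff.mp hg n hn]

theorem coeff_proj (N : ℕ) (f : DirichletHilbert w hw) (n : ℕ) :
    (proj w hw N f).coeff n = (primeWords N).indicator f.coeff n := by
  rw [proj_eq_restrict, coeff_restrict]

theorem absConvergesOn_of_mem_projSubspace {Δ : ℝ} (h : ProjectedWeightCondition w Δ) {N : ℕ}
    {f : DirichletHilbert w hw} (hf : f ∈ projSubspace w hw N) : f.AbsConvergesOn Δ := fun s hs =>
  (tsum_norm_term_le (h N s.re hs) (mem_projSubspace_iff.mp hf)).1

/-- Point evaluation on `𝓗^w_N`. -/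
noncomputable def projEvalCLM {Δ : ℝ} (h : ProjectedWeightCondition w Δ) (N : ℕ) (s : halfPlane Δ) :
    projSubspace w hw N →L[ℂ] ℂ :=
  LinearMap.mkContinuous
    { toFun := fun f => f.1.eval s
      map_add' := fun f g => eval_add (absConvergesOn_of_mem_projSubspace h f.2 s s.2)
        (absConvergesOn_of_mem_projSubspace h g.2 s s.2)
      map_smul' := fun c f => eval_smul c f.1 s } _ fun f =>
    (tsum_norm_term_le (h N (s : ℂ).re s.2) (mem_projSubspace_iff.mp f.2)).2

end Projection

/-! ### Multipliers as convolution operators, and the bound on `π_N φ`. -/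

section Multiplication

variable {σ₀ : ℝ} {φ : ℂ → ℂ}

theorem Represents.eval_eq {Φ : DirichletHilbert w hw} (h : Φ.Represents φ σ₀) {s : ℂ}
    (hs : s ∈ halfPlane σ₀) : Φ.eval s = φ s :=
  (h s hs).LSeries_eq

theorem Represents.unique (hσ₀ : WeightCondition w σ₀) {Φ Ψ : DirichletHilbert w hw}
    (h : Φ.Represents φ σ₀) (h' : Ψ.Represents φ σ₀) : Φ = Ψ :=
  eval_injOn hσ₀ fun s hs => by rw [h.eval_eq hs, h'.eval_eq hs]

/-- This replaces products of functions by Dirichlet convolution, so that later arguments see only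
coefficients. -/
theorem represents_mul_iff (hσ₀ : WeightCondition w σ₀) {Φ f g : DirichletHilbert w hw}
    (hΦ : Φ.Represents φ σ₀) :
    g.Represents (fun s => φ s * f.eval s) σ₀ ↔ g.coeff = Φ.coeff * f.coeff := by
  have hsum : ∀ s ∈ halfPlane σ₀, LSeriesHasSum ⇑(Φ.coeff * f.coeff) s (φ s * f.eval s) :=
    fun s hs => ArithmeticFunction.LSeriesHasSum_mul (hΦ s hs)
      (absConvergesOn hσ₀ f s hs).LSeriesHasSum
  constructor
  · intro hg
    refine coeff_eq_of_eval_eq hσ₀ g ?_ fun s hs => ?_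
    · rw [← ArithmeticFunction.coe_mul]
      exact (LSeries.abscissaOfAbsConv_convolution_le _ _).trans_lt
        (max_lt (abscissa_lt_top hσ₀ Φ) (abscissa_lt_top hσ₀ f))
    · rw [hg.eval_eq hs, (hsum s hs).LSeries_eq]
  · intro hg s hs
    rw [hg]
    exact hsum s hs

theorem eval_monomial_one (s : ℂ) : (monomial w hw 1).eval s = 1 := by
  rw [eval, coeff_monomial_one]
  exact congrFun ((congrArg LSeries ArithmeticFunction.one_eq_delta).trans LSeries_delta) s

theorem exists_represents (hφ : IsMultiplier w hw φ σ₀) :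
    ∃ Φ : DirichletHilbert w hw, Φ.Represents φ σ₀ := by
  obtain ⟨Φ, hΦ⟩ := hφ (monomial w hw 1)
  exact ⟨Φ, fun s hs => by simpa [eval_monomial_one] using hΦ s hs⟩

theorem _root_.IsMultiplicationOperator.coeff_apply (hσ₀ : WeightCondition w σ₀)
    {Φ : DirichletHilbert w hw} (hΦ : Φ.Represents φ σ₀)
    {M : DirichletHilbert w hw →L[ℂ] DirichletHilbert w hw}
    (hM : IsMultiplicationOperator φ σ₀ M) (f : DirichletHilbert w hw) :
    (M f).coeff = Φ.coeff * f.coeff :=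
  (represents_mul_iff hσ₀ hΦ).mp (hM f)

/-- A multiplier acts as a bounded operator, by the closed graph theorem. -/
theorem exists_isMultiplicationOperator (hσ₀ : WeightCondition w σ₀)
    (hφ : IsMultiplier w hw φ σ₀) :
    ∃ M : DirichletHilbert w hw →L[ℂ] DirichletHilbert w hw, IsMultiplicationOperator φ σ₀ M := by
  obtain ⟨Φ, hΦ⟩ := exists_represents hφ
  choose m hm using hφ
  have hc : ∀ f, (m f).coeff = Φ.coeff * f.coeff := fun f =>
    (represents_mul_iff hσ₀ hΦ).mp (hm f)
  let T : DirichletHilbert w hw →ₗ[ℂ] DirichletHilbert w hw :=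
    { toFun := m
      map_add' := fun f g => coeff_ext fun n => by
        rw [coeff_add, hc, hc, hc]
        simp [ArithmeticFunction.mul_apply, coeff_add, mul_add, Finset.sum_add_distrib]
      map_smul' := fun c f => coeff_ext fun n => by
        rw [coeff_smul, hc, RingHom.id_apply, hc]
        simp [ArithmeticFunction.mul_apply, coeff_smul, Finset.mul_sum, mul_left_comm] }
  have hT : Continuous T := by
    refine LinearMap.continuous_of_isClosed_graph T ?_
    -- Each coefficient of a convolution is a finite sum of continuous functionals, so every
    -- condition in the intersection is closed.
    have : (T.graph : Set (DirichletHilbert w hw × DirichletHilbert w hw)) =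
        ⋂ n, {x | x.2.coeff n = (Φ.coeff * x.1.coeff) n} := by
      ext x
      simp only [SetLike.mem_coe, LinearMap.mem_graph_iff, Set.mem_iInter, Set.mem_ofPred_eq]
      constructor
      · intro h n
        rw [h]
        exact congrArg (fun a : ArithmeticFunction ℂ => a n) (hc x.1)
      · intro h
        exact coeff_ext fun n => (h n).trans
          (congrArg (fun a : ArithmeticFunction ℂ => a n) (hc x.1)).symm
    rw [this]
    refine isClosed_iInter fun n => isClosed_eq ((continuous_coeff n).comp continuous_snd) ?_
    simp only [ArithmeticFunction.mul_apply]
    exact continuous_finsetSum _ fun p _ =>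
      continuous_const.mul ((continuous_coeff p.2).comp continuous_fst)
  exact ⟨⟨T, hT⟩, hm⟩

theorem _root_.IsMultiplicationOperator.unique (hσ₀ : WeightCondition w σ₀)
    {M M' : DirichletHilbert w hw →L[ℂ] DirichletHilbert w hw}
    (hM : IsMultiplicationOperator φ σ₀ M) (hM' : IsMultiplicationOperator φ σ₀ M') : M = M' :=
  ContinuousLinearMap.ext fun f => (hM f).unique hσ₀ (hM' f)

theorem mem_primeWords_of_mul {N m n : ℕ} (h : m * n ∈ primeWords N) :
    m ∈ primeWords N ∧ n ∈ primeWords N := by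
  have h0 := primeWords_ne_zero h
  have hm := left_ne_zero_of_mul h0
  have hn := right_ne_zero_of_mul h0
  rw [primeWords, Nat.mem_factoredNumbers_iff_primeFactors_subset] at h ⊢
  rw [Nat.mem_factoredNumbers_iff_primeFactors_subset]
  rw [Nat.primeFactors_mul hm hn, Finset.union_subset_iff] at h
  exact ⟨⟨hm, h.2.1⟩, ⟨hn, h.2.2⟩⟩

/-- Evaluation `E` at `s` satisfies `E (π_N M f) = c * E f` on `𝓗^w_N`, where `c` is the value to be
bounded. Taking norms of functionals gives `|c| ‖E‖ ≤ ‖E‖ ‖M‖`. -/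
theorem norm_eval_proj_le (hσ₀ : WeightCondition w σ₀) {Δ : ℝ} (hΔ : ProjectedWeightCondition w Δ)
    {Φ : DirichletHilbert w hw} (hΦ : Φ.Represents φ σ₀)
    {M : DirichletHilbert w hw →L[ℂ] DirichletHilbert w hw}
    (hM : IsMultiplicationOperator φ σ₀ M) (N : ℕ) {s : ℂ} (hs : s ∈ halfPlane Δ) :
    ‖(proj w hw N Φ).eval s‖ ≤ ‖M‖ := by
  have hmem : ∀ f, proj w hw N f ∈ projSubspace w hw N := fun f =>
    Submodule.starProjection_apply_mem _ f
  set E : projSubspace w hw N →L[ℂ] ℂ := projEvalCLM hΔ N ⟨s, hs⟩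
  set c := (proj w hw N Φ).eval s
  have hmul : ∀ f : projSubspace w hw N,
      (proj w hw N (M f)).eval s = c * E f := by
    intro f
    have h1 : (proj w hw N (M f)).coeff = (proj w hw N Φ).coeff * f.1.coeff := by
      ext n
      rw [coeff_proj, hM.coeff_apply hσ₀ hΦ]
      -- Inside `⟨P_N⟩` both factors of `n` lie in `⟨P_N⟩`, so projecting `Φ` changes nothing.
      -- Outside, one of the two factors does not, so every product vanishes.
      by_cases hn : n ∈ primeWords N
      · rw [Set.indicator_of_mem hn, ArithmeticFunction.mul_apply, ArithmeticFunction.mul_apply]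
        refine Finset.sum_congr rfl fun p hp => ?_
        have hp' := (Nat.mem_divisorsAntidiagonal.mp hp).1
        rw [coeff_proj, Set.indicator_of_mem (mem_primeWords_of_mul (hp' ▸ hn)).1]
      · rw [Set.indicator_of_notMem hn, ArithmeticFunction.mul_apply]
        refine (Finset.sum_eq_zero fun p hp => ?_).symm
        have hp' := (Nat.mem_divisorsAntidiagonal.mp hp).1
        by_cases h1 : p.1 ∈ primeWords N
        · rw [mem_projSubspace_iff.mp f.2 p.2, mul_zero]
          intro h2
          exact hn (hp' ▸ Nat.mul_mem_factoredNumbers h1 h2)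
        · rw [coeff_proj, Set.indicator_of_notMem h1, zero_mul]
    rw [eval, h1]
    exact ArithmeticFunction.LSeries_mul'
      (absConvergesOn_of_mem_projSubspace hΔ (hmem Φ) s hs)
      (absConvergesOn_of_mem_projSubspace hΔ f.2 s hs)
  -- The constant function `1` lies in `𝓗^w_N` and `E` sends it to `1`.
  have hE0 : 0 < ‖E‖ := by
    have h1 : monomial w hw 1 ∈ projSubspace w hw N := by
      refine mem_projSubspace_iff.mpr fun n hn => ?_
      have : n ≠ 1 := fun h => hn (h ▸ by simp [primeWords, Nat.mem_factoredNumbers])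
      simp [coeff_monomial one_ne_zero, this]
    have h2 : E ⟨_, h1⟩ = 1 := eval_monomial_one s
    have h3 := E.le_opNorm ⟨_, h1⟩
    rw [h2, norm_one] at h3
    by_contra h4
    have h5 : ‖E‖ = 0 := le_antisymm (not_lt.mp h4) E.opNorm_nonneg
    rw [h5, zero_mul] at h3
    linarith
  have hle : ∀ f, ‖c‖ * ‖E f‖ ≤ ‖E‖ * ‖M‖ * ‖f‖ := by
    intro f
    have h3 : c * E f = E ⟨_, hmem (M f)⟩ := (hmul f).symm
    rw [← norm_mul, h3]
    refine (E.le_opNorm _).trans ?_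
    rw [mul_assoc]
    gcongr
    exact (Submodule.norm_starProjection_apply_le _ _).trans (M.le_opNorm _)
  rcases (norm_nonneg c).eq_or_lt with hc | hc
  · rw [← hc]
    exact norm_nonneg _
  have h6 : ‖E‖ ≤ ‖E‖ * ‖M‖ / ‖c‖ := by
    refine ContinuousLinearMap.opNorm_le_bound _ (by positivity) fun f => ?_
    rw [div_mul_eq_mul_div, le_div_iff₀ hc, mul_comm]
    exact hle f
  rw [le_div_iff₀ hc] at h6
  exact le_of_mul_le_mul_left h6 hE0

end Multiplication

end DirichletHilbert

/-! ### An integrable kernel that truncates Dirichlet series. -/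

namespace BohrKernel

open MeasureTheory Set FourierTransform

theorem integrable_comp_abs {f : ℝ → ℝ} (hf : IntegrableOn f (Ioi 0)) :
    Integrable fun x : ℝ => f |x| := by
  have h1 : IntegrableOn (fun x : ℝ => f |x|) (Ioi 0) :=
    hf.congr_fun (fun x hx => by rw [abs_of_pos hx]) measurableSet_Ioi
  have h2 : IntegrableOn (fun x : ℝ => f |x|) (Iic 0) := by
    rw [← Measure.map_neg_eq_self (volume : Measure ℝ)]
    let m : MeasurableEmbedding fun x : ℝ => -x := (Homeomorph.neg ℝ).measurableEmbedding
    rw [m.integrableOn_map_iff]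
    simp_rw [Function.comp_def, abs_neg, neg_preimage, neg_Iic, neg_zero]
    exact (integrableOn_Ici_iff_integrableOn_Ioi (f := fun x : ℝ => f |x|)).mpr h1
  rw [← integrableOn_univ, ← Iic_union_Ioi (a := (0 : ℝ))]
  exact h2.union h1

/-- An integrable majorant, of order `|ξ|^(ε-1)` at `0` and `|ξ|^(-1-ε)` at infinity. -/
noncomputable def majorant (ε ξ : ℝ) : ℝ :=
  if |ξ| ≤ 1 then |ξ| ^ (ε - 1) else |ξ| ^ (-1 - ε)

theorem majorant_nonneg (ε ξ : ℝ) : 0 ≤ majorant ε ξ := by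
  unfold majorant
  split_ifs <;> positivity

theorem integrable_majorant {ε : ℝ} (hε : 0 < ε) : Integrable (majorant ε) := by
  refine integrable_comp_abs (f := fun x => if x ≤ 1 then x ^ (ε - 1) else x ^ (-1 - ε)) ?_
  rw [← Ioc_union_Ioi_eq_Ioi (zero_le_one' ℝ)]
  refine IntegrableOn.union ?_ ?_
  · have h : IntegrableOn (fun x : ℝ => x ^ (ε - 1)) (Ioc 0 1) :=
      (intervalIntegrable_iff_integrableOn_Ioc_of_le zero_le_one).mp
        (intervalIntegral.intervalIntegrable_rpow' (by linarith))
    exact h.congr_fun (fun x hx => by simp [hx.2]) measurableSet_Ioc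
  · have h : IntegrableOn (fun x : ℝ => x ^ (-1 - ε)) (Ioi 1) :=
      integrableOn_Ioi_rpow_of_lt (by linarith) one_pos
    exact h.congr_fun (fun x hx => by simp [not_le.mpr (mem_Ioi.mp hx)]) measurableSet_Ioi

/-- Interpolates between `|sin x| ≤ |x|` and `|sin x| ≤ 1`. -/
theorem abs_sin_le_rpow {ε : ℝ} (h0 : 0 ≤ ε) (h1 : ε ≤ 1) (x : ℝ) : |Real.sin x| ≤ |x| ^ ε := by
  rcases le_total |x| 1 with hx | hx
  · rcases (abs_nonneg x).eq_or_lt with h | h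
    · have : x = 0 := abs_eq_zero.mp h.symm
      simp only [this, Real.sin_zero, abs_zero]
      positivity
    · calc |Real.sin x| ≤ |x| := Real.abs_sin_le_abs
        _ = |x| ^ (1 : ℝ) := (Real.rpow_one _).symm
        _ ≤ |x| ^ ε := Real.rpow_le_rpow_of_exponent_ge h hx h1
  · exact (Real.abs_sin_le_one x).trans (Real.one_le_rpow hx h0)

/-- The difference of cosines is a product of two sines. For `|ξ| ≤ 1` they are bounded with
exponents `ε` and `1`, for `|ξ| > 1` with exponents `0` and `1 - ε`. This leaves only a power `ε` of
`a + b` and a power `-ε` of `b - a`. -/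
theorem abs_cos_sub_cos_le {ε : ℝ} (h0 : 0 ≤ ε) (h1 : ε ≤ 1) {a b : ℝ} (ha : 0 ≤ a) (hab : a < b)
    {ξ : ℝ} (hξ : ξ ≠ 0) :
    |(Real.cos (2 * Real.pi * a * ξ) - Real.cos (2 * Real.pi * b * ξ)) /
        ((b - a) * (2 * Real.pi ^ 2 * ξ ^ 2))| ≤
      ((Real.pi * (a + b)) ^ ε + (Real.pi * (b - a)) ^ (-ε)) * majorant ε ξ := by
  have hπ := Real.pi_pos
  have hba : 0 < b - a := sub_pos.mpr hab
  have hx : 0 < |ξ| := abs_pos.mpr hξ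
  have hsum : 0 < a + b := by linarith
  have e1 : |(Real.cos (2 * Real.pi * a * ξ) - Real.cos (2 * Real.pi * b * ξ)) /
        ((b - a) * (2 * Real.pi ^ 2 * ξ ^ 2))| =
      |Real.sin (Real.pi * (a + b) * ξ)| * |Real.sin (Real.pi * (b - a) * ξ)| /
        ((b - a) * Real.pi ^ 2 * |ξ| ^ 2) := by
    rw [Real.cos_sub_cos, abs_div, abs_of_pos (a := (b - a) * (2 * Real.pi ^ 2 * ξ ^ 2))
      (by positivity), sq_abs,
      show (2 * Real.pi * a * ξ + 2 * Real.pi * b * ξ) / 2 = Real.pi * (a + b) * ξ by ring,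
      show (2 * Real.pi * a * ξ - 2 * Real.pi * b * ξ) / 2 = -(Real.pi * (b - a) * ξ) by ring,
      Real.sin_neg, abs_mul, abs_mul, abs_neg, abs_neg]
    rw [abs_of_pos (zero_lt_two' ℝ)]
    field_simp
  have hA : |Real.pi * (a + b) * ξ| = Real.pi * (a + b) * |ξ| := by
    rw [abs_mul, abs_of_pos (by positivity)]
  have hB : |Real.pi * (b - a) * ξ| = Real.pi * (b - a) * |ξ| := by
    rw [abs_mul, abs_of_pos (by positivity)]
  have hP : 0 ≤ (Real.pi * (a + b)) ^ ε := by positivity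
  have hQ : 0 ≤ (Real.pi * (b - a)) ^ (-ε) := by positivity
  rw [e1]
  unfold majorant
  split_ifs with hle
  · have hpw : 0 ≤ |ξ| ^ (ε - 1) := by positivity
    calc _ ≤ (Real.pi * (a + b) * |ξ|) ^ ε * (Real.pi * (b - a) * |ξ|) /
          ((b - a) * Real.pi ^ 2 * |ξ| ^ 2) := by
          gcongr
          · rw [← hA]; exact abs_sin_le_rpow h0 h1 _
          · rw [← hB]; exact Real.abs_sin_le_abs
      _ = (Real.pi * (a + b)) ^ ε * |ξ| ^ (ε - 1) / Real.pi := by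
          rw [Real.mul_rpow (by positivity) (by positivity), Real.rpow_sub_one hx.ne']
          field_simp
      _ ≤ (Real.pi * (a + b)) ^ ε * |ξ| ^ (ε - 1) :=
          div_le_self (by positivity) (by linarith [Real.pi_gt_three])
      _ ≤ _ := by nlinarith
  · have hpw : 0 ≤ |ξ| ^ (-1 - ε) := by positivity
    calc _ ≤ 1 * (Real.pi * (b - a) * |ξ|) ^ (1 - ε) /
          ((b - a) * Real.pi ^ 2 * |ξ| ^ 2) := by
          gcongr
          · exact Real.abs_sin_le_one _
          · rw [← hB]; exact abs_sin_le_rpow (by linarith) (by linarith) _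
      _ = (Real.pi * (b - a)) ^ (-ε) * |ξ| ^ (-1 - ε) / Real.pi := by
          rw [Real.mul_rpow (by positivity) (by positivity), sub_eq_add_neg 1 ε,
            Real.rpow_add (by positivity), Real.rpow_add hx, Real.rpow_one, Real.rpow_one,
            sub_eq_add_neg (-1 : ℝ), Real.rpow_add hx, Real.rpow_neg_one]
          field_simp
      _ ≤ (Real.pi * (b - a)) ^ (-ε) * |ξ| ^ (-1 - ε) :=
          div_le_self (by positivity) (by linarith [Real.pi_gt_three])
      _ ≤ _ := by nlinarith

/-- The tent function of half-width `u`. -/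
noncomputable def tent (u x : ℝ) : ℂ := ((max 0 (u - |x|) : ℝ) : ℂ)

theorem continuous_tent (u : ℝ) : Continuous (tent u) := by
  unfold tent
  fun_prop

theorem support_tent_subset (u : ℝ) : Function.support (tent u) ⊆ Ioo (-u) u := by
  intro x hx
  rw [Function.mem_support] at hx
  rw [mem_Ioo, ← abs_lt]
  by_contra h
  exact hx (by simp [tent, not_lt.mp h])

theorem integrable_tent (u : ℝ) : Integrable (tent u) :=
  (continuous_tent u).integrable_of_hasCompactSupport <|
    HasCompactSupport.intro isCompact_Icc fun x hx => by
      by_contra h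
      exact hx (Ioo_subset_Icc_self (support_tent_subset u h))

theorem fourier_tent {u : ℝ} (hu : 0 ≤ u) {ξ : ℝ} (hξ : ξ ≠ 0) :
    𝓕 (tent u) ξ = ((1 - Real.cos (2 * Real.pi * u * ξ)) / (2 * Real.pi ^ 2 * ξ ^ 2) : ℝ) := by
  set k : ℂ := -2 * Real.pi * ξ * Complex.I with hk
  have hk0 : k ≠ 0 := by
    simp [hk, Real.pi_ne_zero, hξ]
  have hder : ∀ x : ℝ, HasDerivAt (fun x : ℝ => Complex.exp (k * x)) (Complex.exp (k * x) * k) x := by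
    intro x
    have := ((hasDerivAt_id (x : ℂ)).const_mul k).cexp.comp_ofReal
    simpa using this
  have hid : ∀ x : ℝ, HasDerivAt (fun x : ℝ => (x : ℂ)) 1 x := fun x =>
    Complex.ofRealCLM.hasDerivAt
  rw [Real.fourier_real_eq_integral_exp_smul]
  have e1 : ∀ v : ℝ, Complex.exp (↑(-2 * Real.pi * v * ξ) * Complex.I) • tent u v =
      Complex.exp (k * v) * tent u v := by
    intro v
    rw [smul_eq_mul, hk]
    congr 2
    push_cast
    ring
  simp only [e1]
  have hsupp : Function.support (fun v : ℝ => Complex.exp (k * v) * tent u v) ⊆ Ioc (-u) u :=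
    (Function.support_mul_subset_right _ _).trans
      ((support_tent_subset u).trans Ioo_subset_Ioc_self)
  have hcont : Continuous fun v : ℝ => Complex.exp (k * v) * tent u v := by
    have := continuous_tent u
    fun_prop
  rw [← intervalIntegral.integral_eq_integral_of_support_subset hsupp,
    ← intervalIntegral.integral_add_adjacent_intervals (b := 0)
      (hcont.intervalIntegrable _ _) (hcont.intervalIntegrable _ _)]
  have i1 : ∫ v in (-u)..0, Complex.exp (k * v) * tent u v =
      (u / k - 1 / k ^ 2) + Complex.exp (-(k * u)) / k ^ 2 := by
    have : ∫ v in (-u)..0, Complex.exp (k * v) * tent u v =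
        ∫ v in (-u)..0, Complex.exp (k * v) * (u + v) := by
      refine intervalIntegral.integral_congr fun x hx => ?_
      rw [uIcc_of_le (by linarith)] at hx
      simp only [tent, abs_of_nonpos hx.2]
      rw [max_eq_right (by linarith [hx.1])]
      push_cast
      ring
    -- The antiderivative comes from integrating by parts once.
    rw [this, intervalIntegral.integral_eq_sub_of_hasDerivAt
      (f := fun v : ℝ => Complex.exp (k * v) * ((u + v) / k - 1 / k ^ 2))]
    · push_cast
      simp only [mul_zero, Complex.exp_zero, mul_neg]
      ring
    · intro x _
      have := (hder x).mul ((((hid x).const_add (u : ℂ)).div_const k).sub_const (1 / k ^ 2))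
      refine this.congr_deriv ?_
      field_simp
      ring
    · exact Continuous.intervalIntegrable (by fun_prop) _ _
  have i2 : ∫ v in (0 : ℝ)..u, Complex.exp (k * v) * tent u v =
      Complex.exp (k * u) / k ^ 2 - (u / k + 1 / k ^ 2) := by
    have : ∫ v in (0 : ℝ)..u, Complex.exp (k * v) * tent u v =
        ∫ v in (0 : ℝ)..u, Complex.exp (k * v) * (u - v) := by
      refine intervalIntegral.integral_congr fun x hx => ?_
      rw [uIcc_of_le (by linarith)] at hx
      simp only [tent, abs_of_nonneg hx.1]
      rw [max_eq_right (by linarith [hx.2])]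
      push_cast
      ring
    rw [this, intervalIntegral.integral_eq_sub_of_hasDerivAt
      (f := fun v : ℝ => Complex.exp (k * v) * ((u - v) / k + 1 / k ^ 2))]
    · push_cast
      simp only [mul_zero, Complex.exp_zero]
      ring
    · intro x _
      have := (hder x).mul ((((hid x).const_sub (u : ℂ)).div_const k).add_const (1 / k ^ 2))
      refine this.congr_deriv ?_
      field_simp
      ring
    · exact Continuous.intervalIntegrable (by fun_prop) _ _
  rw [i1, i2]
  have e2 : Complex.exp (k * u) + Complex.exp (-(k * u)) =
      2 * (Real.cos (2 * Real.pi * u * ξ) : ℂ) := by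
    rw [Complex.ofReal_cos, Complex.two_cos, add_comm]
    congr 2 <;> rw [hk] <;> push_cast <;> ring
  have e3 : k ^ 2 = -(4 * Real.pi ^ 2 * ξ ^ 2) := by
    rw [hk, mul_pow, Complex.I_sq]
    ring
  calc _ = ((Complex.exp (k * u) + Complex.exp (-(k * u))) - 2) / k ^ 2 := by ring
    _ = _ := by
      rw [e2, e3]
      have h1 : (Real.pi : ℂ) ≠ 0 := Complex.ofReal_ne_zero.mpr Real.pi_ne_zero
      have h2 : (ξ : ℂ) ≠ 0 := Complex.ofReal_ne_zero.mpr hξ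
      push_cast
      field_simp
      ring

/-- The trapezoid function, equal to `1` on `[-a, a]` and to `0` off `[-b, b]`. -/
noncomputable def trapezoid (a b x : ℝ) : ℂ := ((b - a : ℝ) : ℂ)⁻¹ * (tent b x - tent a x)

theorem trapezoid_eq_one {a b x : ℝ} (hab : a < b) (hx : |x| ≤ a) : trapezoid a b x = 1 := by
  have h : ((b - a : ℝ) : ℂ) ≠ 0 := Complex.ofReal_ne_zero.mpr (sub_pos.mpr hab).ne'
  rw [trapezoid, tent, tent, max_eq_right (by linarith), max_eq_right (by linarith),
    ← Complex.ofReal_sub, show b - |x| - (a - |x|) = b - a by ring, inv_mul_cancel₀ h]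

theorem trapezoid_eq_zero {a b x : ℝ} (hab : a < b) (hx : b ≤ |x|) : trapezoid a b x = 0 := by
  simp [trapezoid, tent, max_eq_left (show b - |x| ≤ 0 by linarith),
    max_eq_left (show a - |x| ≤ 0 by linarith)]

theorem continuous_trapezoid (a b : ℝ) : Continuous (trapezoid a b) :=
  continuous_const.mul ((continuous_tent b).sub (continuous_tent a))

theorem integrable_trapezoid (a b : ℝ) : Integrable (trapezoid a b) :=
  ((integrable_tent b).sub (integrable_tent a)).const_mul _

theorem fourier_trapezoid {a b : ℝ} (ha : 0 ≤ a) (hab : a < b) {ξ : ℝ} (hξ : ξ ≠ 0) :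
    𝓕 (trapezoid a b) ξ =
      ((Real.cos (2 * Real.pi * a * ξ) - Real.cos (2 * Real.pi * b * ξ)) /
        ((b - a) * (2 * Real.pi ^ 2 * ξ ^ 2)) : ℝ) := by
  have hint : ∀ u, Integrable fun v : ℝ => Real.fourierChar (-(v * ξ)) • tent u v := by
    intro u
    have := (Real.fourierIntegral_convergent_iff (f := tent u) ξ).mpr (integrable_tent u)
    simpa [mul_comm] using this
  have h1 : 𝓕 (trapezoid a b) ξ = ((b - a : ℝ) : ℂ)⁻¹ * (𝓕 (tent b) ξ - 𝓕 (tent a) ξ) := by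
    simp only [Real.fourier_real_eq]
    rw [← integral_sub (hint b) (hint a), ← integral_const_mul]
    congr 1
    ext v
    simp only [trapezoid, Circle.smul_def, smul_eq_mul]
    ring
  rw [h1, fourier_tent (ha.trans hab.le) hξ, fourier_tent ha hξ, ← Complex.ofReal_inv,
    ← Complex.ofReal_sub, ← Complex.ofReal_mul]
  congr 1
  have hba : b - a ≠ 0 := (sub_pos.mpr hab).ne'
  have := Real.pi_ne_zero
  field_simp
  ring

theorem norm_fourier_trapezoid_le {ε : ℝ} (h0 : 0 ≤ ε) (h1 : ε ≤ 1) {a b : ℝ} (ha : 0 ≤ a)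
    (hab : a < b) : ∀ᵐ ξ, ‖𝓕 (trapezoid a b) ξ‖ ≤
      ((Real.pi * (a + b)) ^ ε + (Real.pi * (b - a)) ^ (-ε)) * majorant ε ξ := by
  filter_upwards [compl_mem_ae_iff.mpr (measure_singleton (0 : ℝ))] with ξ hξ
  rw [fourier_trapezoid ha hab hξ, Complex.norm_real, Real.norm_eq_abs]
  exact abs_cos_sub_cos_le h0 h1 ha hab hξ

theorem integrable_fourier_trapezoid {a b : ℝ} (ha : 0 ≤ a) (hab : a < b) :
    Integrable (𝓕 (trapezoid a b)) := by
  -- Any exponent in `(0, 1]` would serve here.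
  refine Integrable.mono' ((integrable_majorant one_half_pos).const_mul _) ?_
    (norm_fourier_trapezoid_le one_half_pos.le one_half_lt_one.le ha hab)
  have : Continuous (𝓕 (trapezoid a b)) :=
    VectorFourier.fourierIntegral_continuous Real.continuous_fourierChar
      (by fun_prop) (integrable_trapezoid a b)
  exact this.aestronglyMeasurable

/-- An `L¹` kernel of norm `O((N+1)^ε)` reproducing the partial sums of order `N`. -/
theorem exists_kernel {ε : ℝ} (h0 : 0 < ε) (h1 : ε ≤ 1) : ∃ C : ℝ, 0 ≤ C ∧ ∀ N : ℕ, N ≠ 0 →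
    ∃ k : ℝ → ℂ, Integrable k ∧ ∫ ξ, ‖k ξ‖ ≤ C * ((N : ℝ) + 1) ^ ε ∧
      ∀ n : ℕ, n ≠ 0 → ∫ ξ : ℝ, k ξ * (n : ℂ) ^ (2 * Real.pi * ξ * Complex.I) =
        if n ≤ N then 1 else 0 := by
  refine ⟨((2 * Real.pi) ^ ε + 1) * ∫ ξ, majorant ε ξ,
    mul_nonneg (by positivity) (integral_nonneg fun ξ => majorant_nonneg ε ξ), fun N hN => ?_⟩
  have hπ := Real.pi_gt_three
  have hN1 : (1 : ℝ) ≤ N := by exact_mod_cast Nat.one_le_iff_ne_zero.mpr hN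
  have ha : 0 ≤ Real.log N := Real.log_nonneg hN1
  have hab : Real.log N < Real.log (N + 1) := Real.log_lt_log (by linarith) (by linarith)
  have hint := integrable_fourier_trapezoid ha hab
  -- No `log n` lies strictly between `log N` and `log (N+1)`, so the trapezoid is a sharp cutoff at
  -- integers. Fourier inversion at `log n` produces the factor `n^(2πiξ)`.
  refine ⟨𝓕 (trapezoid (Real.log N) (Real.log (N + 1))), hint, ?_, fun n hn => ?_⟩
  -- The gap `b - a` is at least `1/(N+1)` and enters with the power `-ε`. This costs the factor
  -- `(N+1)^ε`.
  · have hd : ((N : ℝ) + 1)⁻¹ ≤ Real.log (N + 1) - Real.log N := by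
      have := Real.one_sub_inv_le_log_of_pos (x := ((N : ℝ) + 1) / N) (by positivity)
      rw [Real.log_div (by positivity) (by positivity)] at this
      refine le_trans (le_of_eq ?_) this
      field_simp
      ring
    have hs : Real.pi * (Real.log N + Real.log (N + 1)) ≤ 2 * Real.pi * ((N : ℝ) + 1) := by
      have := Real.log_le_self (x := (N : ℝ) + 1) (by positivity)
      nlinarith
    have c1 : (Real.pi * (Real.log N + Real.log (N + 1))) ^ ε ≤
        (2 * Real.pi) ^ ε * ((N : ℝ) + 1) ^ ε := by
      rw [← Real.mul_rpow (by positivity) (by positivity)]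
      exact Real.rpow_le_rpow (mul_nonneg (by positivity) (by linarith)) hs h0.le
    have c2 : (Real.pi * (Real.log (N + 1) - Real.log N)) ^ (-ε) ≤ ((N : ℝ) + 1) ^ ε := by
      have h2 : ((N : ℝ) + 1)⁻¹ ≤ Real.pi * (Real.log (N + 1) - Real.log N) := by
        nlinarith [sub_pos.mpr hab]
      calc _ ≤ (((N : ℝ) + 1)⁻¹) ^ (-ε) :=
            Real.rpow_le_rpow_of_nonpos (by positivity) h2 (by linarith)
        _ = _ := by rw [Real.inv_rpow (by positivity), Real.rpow_neg (by positivity), inv_inv]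
    refine (integral_mono_ae hint.norm ((integrable_majorant h0).const_mul _)
      (norm_fourier_trapezoid_le h0.le h1 ha hab)).trans ?_
    rw [integral_const_mul, mul_right_comm]
    refine mul_le_mul_of_nonneg_right ?_ (integral_nonneg fun ξ => majorant_nonneg ε ξ)
    linarith
  · have hn0 : (0 : ℝ) < n := by positivity
    have hinv := congrFun (Continuous.fourierInv_fourier_eq (continuous_trapezoid _ _)
      (integrable_trapezoid _ _) hint) (Real.log n)
    have hlog : 0 ≤ Real.log n := Real.log_natCast_nonneg n
    have e1 : ∫ ξ : ℝ, 𝓕 (trapezoid (Real.log N) (Real.log (N + 1))) ξ *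
        (n : ℂ) ^ (2 * Real.pi * ξ * Complex.I) =
        trapezoid (Real.log N) (Real.log (N + 1)) (Real.log n) := by
      rw [← hinv, Real.fourierInv_eq']
      congr 1
      ext ξ
      rw [smul_eq_mul, mul_comm, Complex.cpow_def_of_ne_zero (by exact_mod_cast hn),
        ← Complex.natCast_log]
      congr 2
      simp
      ring
    rw [e1]
    split_ifs with hle
    · refine trapezoid_eq_one hab ?_
      rw [abs_of_nonneg hlog]
      exact Real.log_le_log hn0 (by exact_mod_cast hle)
    · refine trapezoid_eq_zero hab ?_
      rw [abs_of_nonneg hlog]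
      refine Real.log_le_log (by positivity) ?_
      exact_mod_cast Nat.succ_le_of_lt (not_le.mp hle)

end BohrKernel

/-- **Bohr's inequality** for the partial sums of a bounded, absolutely convergent Dirichlet
series. -/
theorem exists_norm_partialSum_le {ε : ℝ} (h0 : 0 < ε) (h1 : ε ≤ 1) :
    ∃ C : ℝ, 0 ≤ C ∧ ∀ (a : ℕ → ℂ) (Δ B : ℝ), (∀ s ∈ halfPlane Δ, LSeriesSummable a s) →
      (∀ s ∈ halfPlane Δ, ‖LSeries a s‖ ≤ B) → ∀ s ∈ halfPlane Δ, ∀ N : ℕ,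
      ‖∑ n ∈ Finset.Icc 1 N, a n * (n : ℂ) ^ (-s)‖ ≤ B * C * ((N : ℝ) + 1) ^ ε := by
  obtain ⟨C, hC, hk⟩ := BohrKernel.exists_kernel h0 h1
  refine ⟨C, hC, fun a Δ B ha hB s hs N => ?_⟩
  have hB0 : 0 ≤ B := (norm_nonneg _).trans (hB s hs)
  rcases eq_or_ne N 0 with rfl | hN
  · simpa using mul_nonneg hB0 hC
  obtain ⟨k, hkint, hknorm, hkval⟩ := hk N hN
  -- Vertical translates of `s` remain in the half-plane where the bound `B` holds. Integrating them
  -- against `k` extracts the partial sum at `s`.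
  set z : ℝ → ℂ := fun ξ => s - 2 * Real.pi * ξ * Complex.I with hz
  have hzre : ∀ ξ, (z ξ).re = s.re := fun ξ => by simp [hz]
  have hzmem : ∀ ξ, z ξ ∈ halfPlane Δ := fun ξ => by
    simpa [halfPlane, hzre] using hs
  have hterm : ∀ ξ n, LSeries.term a (z ξ) n =
      LSeries.term a s n * (n : ℂ) ^ (2 * Real.pi * ξ * Complex.I) := by
    intro ξ n
    rcases eq_or_ne n 0 with rfl | hn
    · simp
    · have hn0 : (n : ℂ) ≠ 0 := by exact_mod_cast hn
      rw [LSeries.term_of_ne_zero hn, LSeries.term_of_ne_zero hn, hz, Complex.cpow_sub _ _ hn0]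
      rw [div_div_eq_mul_div, mul_div_right_comm]
  have hnorm : ∀ ξ n, ‖LSeries.term a (z ξ) n‖ = ‖LSeries.term a s n‖ := by
    intro ξ n
    rw [LSeries.norm_term_eq, LSeries.norm_term_eq, hzre]
  have hmeas : ∀ n, Continuous fun ξ => LSeries.term a (z ξ) n := by
    intro n
    rcases eq_or_ne n 0 with rfl | hn
    · simpa using continuous_const
    · simp only [hterm]
      refine continuous_const.mul (Continuous.const_cpow (by fun_prop) (Or.inl ?_))
      exact_mod_cast hn
  have hFint : ∀ n, MeasureTheory.Integrable fun ξ => LSeries.term a (z ξ) n * k ξ := fun n =>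
    hkint.bdd_mul (hmeas n).aestronglyMeasurable (MeasureTheory.ae_of_all _ fun ξ => (hnorm ξ n).le)
  have hsum := MeasureTheory.hasSum_integral_of_summable_integral_norm hFint (by
    simp only [norm_mul, hnorm]
    simp only [MeasureTheory.integral_const_mul]
    exact (ha s hs).norm.mul_right _)
  have hval : ∀ n, ∫ ξ, LSeries.term a (z ξ) n * k ξ =
      if n ∈ Finset.Icc 1 N then a n * (n : ℂ) ^ (-s) else 0 := by
    intro n
    rcases eq_or_ne n 0 with rfl | hn
    · simp
    · have : ∀ ξ, LSeries.term a (z ξ) n * k ξ =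
          LSeries.term a s n * (k ξ * (n : ℂ) ^ (2 * Real.pi * ξ * Complex.I)) := fun ξ => by
        rw [hterm]
        ring
      simp only [this]
      rw [MeasureTheory.integral_const_mul]
      rw [hkval n hn, LSeries.term_of_ne_zero hn, Complex.cpow_neg]
      simp [Nat.one_le_iff_ne_zero.mpr hn, div_eq_mul_inv]
  have hS : ∑ n ∈ Finset.Icc 1 N, a n * (n : ℂ) ^ (-s) = ∫ ξ, LSeries a (z ξ) * k ξ := by
    simp only [hval, tsum_mul_right] at hsum
    refine HasSum.unique ?_ hsum
    rw [← Finset.sum_congr rfl fun n hn => if_pos hn]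
    exact hasSum_sum_of_ne_finset_zero fun n hn => if_neg hn
  rw [hS]
  calc _ ≤ ∫ ξ, B * ‖k ξ‖ := by
        refine MeasureTheory.norm_integral_le_of_norm_le (hkint.norm.const_mul B)
          (MeasureTheory.ae_of_all _ fun ξ => ?_)
        rw [norm_mul]
        exact mul_le_mul_of_nonneg_right (hB _ (hzmem ξ)) (norm_nonneg _)
    _ ≤ B * (C * ((N : ℝ) + 1) ^ ε) := by
        rw [MeasureTheory.integral_const_mul]
        exact mul_le_mul_of_nonneg_left hknorm hB0
    _ = _ := by ring

/-! ### Summation by parts and passage to the limit in `N`. -/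

/-- The partial sums of a Dirichlet series. -/
noncomputable def partialSum (a : ℕ → ℂ) (s : ℂ) (K : ℕ) : ℂ :=
  ∑ n ∈ Finset.Icc 1 K, a n * (n : ℂ) ^ (-s)

/-- The differences `(n+1)^(-η) - (n+2)^(-η)` occurring in summation by parts. -/
noncomputable def rpowDiff (η : ℝ) (n : ℕ) : ℝ := ((n : ℝ) + 1) ^ (-η) - ((n : ℝ) + 2) ^ (-η)

/-- The sum of a Dirichlet series at `s + η`, expressed by its partial sums at `s`. -/
noncomputable def abelSum (a : ℕ → ℂ) (η : ℝ) (s : ℂ) : ℂ :=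
  ∑' n : ℕ, partialSum a s (n + 1) * (rpowDiff η n : ℂ)

theorem partialSum_succ (a : ℕ → ℂ) (s : ℂ) (K : ℕ) :
    partialSum a s (K + 1) = partialSum a s K + a (K + 1) * ((K + 1 : ℕ) : ℂ) ^ (-s) :=
  Finset.sum_Icc_succ_top (by omega) _

theorem partialSum_zero (a : ℕ → ℂ) (s : ℂ) : partialSum a s 0 = 0 := by
  simp [partialSum]

/-- Abel summation. The boundary weight is taken at `K + 1` rather than `K`, so the formula also
holds at `K = 0`. -/
theorem partialSum_add (a : ℕ → ℂ) (s : ℂ) (η : ℝ) (K : ℕ) :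
    partialSum a (s + η) K = partialSum a s K * ((((K : ℝ) + 1) ^ (-η) : ℝ) : ℂ) +
      ∑ n ∈ Finset.range K, partialSum a s (n + 1) * (rpowDiff η n : ℂ) := by
  induction K with
  | zero => simp [partialSum_zero]
  | succ K ih =>
    have h1 : ((K + 1 : ℕ) : ℂ) ^ (-(s + η)) =
        ((K + 1 : ℕ) : ℂ) ^ (-s) * ((((K : ℝ) + 1) ^ (-η) : ℝ) : ℂ) := by
      rw [neg_add, Complex.cpow_add _ _ (by exact_mod_cast K.succ_ne_zero),
        Complex.ofReal_cpow (by positivity)]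
      push_cast
      rfl
    rw [partialSum_succ, ih, Finset.sum_range_succ, h1, partialSum_succ, rpowDiff]
    push_cast
    rw [show (K : ℝ) + 1 + 1 = K + 2 by ring]
    ring

theorem rpowDiff_nonneg {η : ℝ} (hη : 0 ≤ η) (n : ℕ) : 0 ≤ rpowDiff η n :=
  sub_nonneg.mpr (Real.rpow_le_rpow_of_nonpos (by positivity) (by linarith) (by linarith))

theorem summable_rpowDiff {η : ℝ} (hη : 0 ≤ η) : Summable (rpowDiff η) := by
  refine summable_of_sum_range_le (c := 1) (rpowDiff_nonneg hη) fun K => ?_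
  have h : ∀ K : ℕ, ∑ n ∈ Finset.range K, rpowDiff η n = 1 - ((K : ℝ) + 1) ^ (-η) := by
    intro K
    induction K with
    | zero => simp
    | succ K ih =>
      rw [Finset.sum_range_succ, ih, rpowDiff]
      push_cast
      rw [show (K : ℝ) + 1 + 1 = K + 2 by ring]
      ring
  rw [h]
  have : 0 ≤ ((K : ℝ) + 1) ^ (-η) := by positivity
  linarith

/-- A difference of squares: `x^(-2ε) - y^(-2ε) = (x^(-ε) - y^(-ε)) (x^(-ε) + y^(-ε))`. The second
factor absorbs the growth `y^ε` (the product is at most `2 + 1`), and the first telescopes. Hence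
partial sums of order `ε` require a shift by `2ε`. -/
theorem summable_rpow_mul_rpowDiff {ε : ℝ} (h0 : 0 ≤ ε) (h1 : ε ≤ 1) :
    Summable fun n : ℕ => ((n : ℝ) + 2) ^ ε * rpowDiff (2 * ε) n := by
  refine Summable.of_nonneg_of_le
    (fun n => mul_nonneg (by positivity) (rpowDiff_nonneg (by linarith) n)) (fun n => ?_)
    ((summable_rpowDiff h0).mul_left 4)
  have ha : (0 : ℝ) < (n : ℝ) + 1 := by positivity
  have hb : (0 : ℝ) < (n : ℝ) + 2 := by positivity
  have hd := rpowDiff_nonneg h0 n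
  have e : ∀ x : ℝ, 0 < x → x ^ (-(2 * ε)) = (x ^ (-ε)) ^ 2 := fun x hx => by
    rw [← Real.rpow_natCast, ← Real.rpow_mul hx.le]
    congr 1
    push_cast
    ring
  have hy : ((n : ℝ) + 2) ^ ε * ((n : ℝ) + 2) ^ (-ε) = 1 := by
    rw [← Real.rpow_add hb, add_neg_cancel, Real.rpow_zero]
  have hx : ((n : ℝ) + 2) ^ ε * ((n : ℝ) + 1) ^ (-ε) ≤ 2 := by
    rw [Real.rpow_neg ha.le, ← div_eq_mul_inv, ← Real.div_rpow hb.le ha.le]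
    have h2 : 1 ≤ ((n : ℝ) + 2) / (n + 1) := by rw [le_div_iff₀ ha]; linarith
    calc _ ≤ (((n : ℝ) + 2) / (n + 1)) ^ (1 : ℝ) := Real.rpow_le_rpow_of_exponent_le h2 h1
      _ ≤ 2 := by
        rw [Real.rpow_one, div_le_iff₀ ha]
        have : (0 : ℝ) ≤ n := by positivity
        linarith
  have hfac : ((n : ℝ) + 2) ^ ε * rpowDiff (2 * ε) n =
      (((n : ℝ) + 2) ^ ε * ((n : ℝ) + 1) ^ (-ε) + ((n : ℝ) + 2) ^ ε * ((n : ℝ) + 2) ^ (-ε)) *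
        rpowDiff ε n := by
    rw [rpowDiff, rpowDiff, e _ ha, e _ hb]
    ring
  rw [hfac, hy]
  exact mul_le_mul_of_nonneg_right (by linarith) hd

section Abel

variable {a : ℕ → ℂ} {s : ℂ} {ε B : ℝ}

theorem norm_abelSum_term_le (h0 : 0 ≤ ε)
    (hB : ∀ K : ℕ, ‖partialSum a s K‖ ≤ B * ((K : ℝ) + 1) ^ ε) (n : ℕ) :
    ‖partialSum a s (n + 1) * (rpowDiff (2 * ε) n : ℂ)‖ ≤
      B * (((n : ℝ) + 2) ^ ε * rpowDiff (2 * ε) n) := by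
  have hd := rpowDiff_nonneg (η := 2 * ε) (by linarith) n
  rw [norm_mul, Complex.norm_real, Real.norm_of_nonneg hd, ← mul_assoc]
  refine mul_le_mul_of_nonneg_right ((hB (n + 1)).trans_eq ?_) hd
  push_cast
  rw [add_assoc]
  norm_num

theorem dirichletConvergesTo_abelSum (h0 : 0 < ε) (h1 : ε ≤ 1)
    (hB : ∀ K : ℕ, ‖partialSum a s K‖ ≤ B * ((K : ℝ) + 1) ^ ε) :
    DirichletConvergesTo a (s + (2 * ε : ℝ)) (abelSum a (2 * ε) s) := by
  have hsum : Summable fun n : ℕ => partialSum a s (n + 1) * (rpowDiff (2 * ε) n : ℂ) :=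
    Summable.of_norm_bounded ((summable_rpow_mul_rpowDiff h0.le h1).mul_left B)
      (norm_abelSum_term_le h0.le hB)
  have hlim := hsum.hasSum.tendsto_sum_nat
  -- The boundary term is `O(K^(-ε))`.
  have hz : Tendsto (fun K : ℕ => partialSum a s K * ((((K : ℝ) + 1) ^ (-(2 * ε)) : ℝ) : ℂ))
      atTop (𝓝 0) := by
    refine squeeze_zero_norm (a := fun K : ℕ => B * ((K : ℝ) + 1) ^ (-ε)) (fun K => ?_) ?_
    · rw [norm_mul, Complex.norm_real, Real.norm_of_nonneg (by positivity)]
      refine (mul_le_mul_of_nonneg_right (hB K) (by positivity)).trans_eq ?_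
      rw [mul_assoc, ← Real.rpow_add (by positivity)]
      congr 2
      ring
    · rw [← mul_zero B]
      refine Tendsto.const_mul B ((tendsto_rpow_neg_atTop h0).comp ?_)
      exact tendsto_atTop_add_const_right _ _ tendsto_natCast_atTop_atTop
  have := hz.add hlim
  rw [zero_add] at this
  refine this.congr fun K => ?_
  exact (partialSum_add a s (2 * ε) K).symm

end Abel

theorem LSeriesHasSum.dirichletConvergesTo {a : ℕ → ℂ} {s z : ℂ} (h : LSeriesHasSum a s z) :
    DirichletConvergesTo a s z := by
  have h1 : Tendsto (fun K : ℕ => ∑ n ∈ Finset.range (K + 1), LSeries.term a s n) atTop (𝓝 z) :=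
    (HasSum.tendsto_sum_nat h).comp (tendsto_add_atTop_nat 1)
  refine h1.congr fun K => ?_
  rw [Finset.sum_range_succ', LSeries.term_zero, add_zero, Finset.range_eq_Ico,
    Finset.sum_Ico_add' (fun n => LSeries.term a s n) 0 K 1]
  refine Finset.sum_congr (by ext; simp) fun n hn => ?_
  have : n ≠ 0 := by
    have := (Finset.mem_Icc.mp hn).1
    omega
  rw [LSeries.term_of_ne_zero this, Complex.cpow_neg, div_eq_mul_inv]

theorem isOpen_halfPlane (σ : ℝ) : IsOpen (halfPlane σ) :=
  isOpen_lt continuous_const Complex.continuous_re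

theorem differentiable_partialSum (a : ℕ → ℂ) (K : ℕ) :
    Differentiable ℂ fun s => partialSum a s K := by
  unfold partialSum
  refine Differentiable.fun_sum fun n hn => ?_
  have : (n : ℂ) ≠ 0 := by
    have := (Finset.mem_Icc.mp hn).1
    exact_mod_cast (by omega : n ≠ 0)
  exact (differentiable_neg.const_cpow (Or.inl this)).const_mul _

/-- If Dirichlet series `a_N` that converge absolutely and are bounded by `B` on `Ω_Δ` have
coefficients that are eventually those of `a`, then `a` converges on `Ω_Δ` to an analytic function
bounded by `B`. -/
theorem exists_bounded_sum_of_eventually_eq {a : ℕ → ℂ} {b : ℕ → ℕ → ℂ} {Δ B : ℝ}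
    (hb : ∀ N, ∀ s ∈ halfPlane Δ, LSeriesSummable (b N) s)
    (hB : ∀ N, ∀ s ∈ halfPlane Δ, ‖LSeries (b N) s‖ ≤ B)
    (hab : ∀ n, ∀ᶠ N in atTop, b N n = a n) :
    ∃ ψ : ℂ → ℂ, DifferentiableOn ℂ ψ (halfPlane Δ) ∧
      (∀ s ∈ halfPlane Δ, DirichletConvergesTo a s (ψ s)) ∧
      ∀ s ∈ halfPlane Δ, ‖ψ s‖ ≤ B := by
  have hpartial : ∀ s K, ∀ᶠ N in atTop, partialSum (b N) s K = partialSum a s K := by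
    intro s K
    have : ∀ᶠ N in atTop, ∀ n ∈ Finset.Icc 1 K, b N n = a n :=
      (Finset.eventually_all _).mpr fun n _ => hab n
    filter_upwards [this] with N hN
    exact Finset.sum_congr rfl fun n hn => by rw [hN n hn]
  have key : ∀ ε : ℝ, 0 < ε → ε ≤ 1 →
      (∀ s ∈ halfPlane (Δ + 2 * ε), DirichletConvergesTo a s (abelSum a (2 * ε) (s - (2 * ε : ℝ)))) ∧
      (∀ s ∈ halfPlane (Δ + 2 * ε), ‖abelSum a (2 * ε) (s - (2 * ε : ℝ))‖ ≤ B) ∧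
      DifferentiableOn ℂ (fun s => abelSum a (2 * ε) (s - (2 * ε : ℝ))) (halfPlane (Δ + 2 * ε)) := by
    intro ε h0 h1
    obtain ⟨C, hC, hbohr⟩ := exists_norm_partialSum_le h0 h1
    have hbN : ∀ N, ∀ s ∈ halfPlane Δ, ∀ K : ℕ,
        ‖partialSum (b N) s K‖ ≤ B * C * ((K : ℝ) + 1) ^ ε := fun N =>
      hbohr (b N) Δ B (hb N) (hB N)
    -- The growth bound is uniform in `N`, and a fixed partial sum of `a` equals that of `b N` for
    -- some `N`.
    have haK : ∀ s ∈ halfPlane Δ, ∀ K : ℕ,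
        ‖partialSum a s K‖ ≤ B * C * ((K : ℝ) + 1) ^ ε := by
      intro s hs K
      obtain ⟨N, hN⟩ := (hpartial s K).exists
      rw [← hN]
      exact hbN N s hs K
    have hshift : ∀ s ∈ halfPlane (Δ + 2 * ε), s - (2 * ε : ℝ) ∈ halfPlane Δ := by
      intro s hs
      simp only [halfPlane, Set.mem_ofPred_eq, Complex.sub_re, Complex.ofReal_re] at hs ⊢
      linarith
    have hmono : ∀ s ∈ halfPlane (Δ + 2 * ε), s ∈ halfPlane Δ := by
      intro s hs
      simp only [halfPlane, Set.mem_ofPred_eq] at hs ⊢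
      linarith
    refine ⟨fun s hs => ?_, fun s hs => ?_, ?_⟩
    · simpa using dirichletConvergesTo_abelSum h0 h1 (haK _ (hshift s hs))
    -- The bound `B` is known for the sums of `b N`. It survives because Abel sums, unlike the raw
    -- series, have a summable majorant independent of `N`.
    · have hval : ∀ N, LSeries (b N) s = abelSum (b N) (2 * ε) (s - (2 * ε : ℝ)) := by
        intro N
        have c1 := dirichletConvergesTo_abelSum h0 h1 (hbN N _ (hshift s hs))
        rw [sub_add_cancel] at c1
        exact tendsto_nhds_unique (hb N s (hmono s hs)).LSeriesHasSum.dirichletConvergesTo c1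
      have hlim : Tendsto (fun N => abelSum (b N) (2 * ε) (s - (2 * ε : ℝ))) atTop
          (𝓝 (abelSum a (2 * ε) (s - (2 * ε : ℝ)))) := by
        refine tendsto_tsum_of_dominated_convergence
          ((summable_rpow_mul_rpowDiff h0.le h1).mul_left (B * C)) (fun n => ?_)
          (Eventually.of_forall fun N n => norm_abelSum_term_le h0.le (hbN N _ (hshift s hs)) n)
        refine tendsto_const_nhds.congr' ?_
        filter_upwards [hpartial (s - (2 * ε : ℝ)) (n + 1)] with N hN
        rw [hN]
      refine le_of_tendsto hlim.norm (Eventually.of_forall fun N => ?_)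
      rw [← hval]
      exact hB N s (hmono s hs)
    · refine Complex.differentiableOn_tsum_of_summable_norm
        ((summable_rpow_mul_rpowDiff h0.le h1).mul_left (B * C)) (fun n => ?_)
        (isOpen_halfPlane _) fun n s hs => norm_abelSum_term_le h0.le (haK _ (hshift s hs)) n
      exact (((differentiable_partialSum a (n + 1)).comp
        (differentiable_id.sub_const _)).mul_const _).differentiableOn
  have hε : ∀ s ∈ halfPlane Δ, ∃ ε : ℝ, 0 < ε ∧ ε ≤ 1 ∧ s ∈ halfPlane (Δ + 2 * ε) := by
    intro s hs
    simp only [halfPlane, Set.mem_ofPred_eq] at hs ⊢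
    -- With this choice the shift `2ε` is at most half the distance to the boundary.
    refine ⟨min 1 ((s.re - Δ) / 4), lt_min one_pos (by linarith), min_le_left _ _, ?_⟩
    have := min_le_right 1 ((s.re - Δ) / 4)
    linarith
  have hex : ∀ s : ℂ, ∃ z, s ∈ halfPlane Δ → DirichletConvergesTo a s z := by
    intro s
    by_cases hs : s ∈ halfPlane Δ
    · obtain ⟨ε, h0, h1, h2⟩ := hε s hs
      exact ⟨_, fun _ => (key ε h0 h1).1 s h2⟩
    · exact ⟨0, fun h => absurd h hs⟩
  -- The limit does not depend on `ε`, so the Abel sums for different `ε` glue to one function.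
  choose ψ hψ using hex
  have hψeq : ∀ ε : ℝ, 0 < ε → ε ≤ 1 → ∀ s ∈ halfPlane (Δ + 2 * ε),
      ψ s = abelSum a (2 * ε) (s - (2 * ε : ℝ)) := by
    intro ε h0 h1 s hs
    refine tendsto_nhds_unique (hψ s ?_) ((key ε h0 h1).1 s hs)
    simp only [halfPlane, Set.mem_ofPred_eq] at hs ⊢
    linarith
  refine ⟨ψ, fun s hs => ?_, hψ, fun s hs => ?_⟩
  · obtain ⟨ε, h0, h1, h2⟩ := hε s hs
    have hnhds := (isOpen_halfPlane (Δ + 2 * ε)).mem_nhds h2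
    refine DifferentiableAt.differentiableWithinAt ?_
    refine ((key ε h0 h1).2.2.differentiableAt hnhds).congr_of_eventuallyEq ?_
    filter_upwards [hnhds] with z hz
    exact hψeq ε h0 h1 z hz
  · obtain ⟨ε, h0, h1, h2⟩ := hε s hs
    rw [hψeq ε h0 h1 s h2]
    exact (key ε h0 h1).2.1 s h2

theorem eventually_mem_primeWords {n : ℕ} (hn : n ≠ 0) : ∀ᶠ N in atTop, n ∈ primeWords N := by
  filter_upwards [eventually_gt_atTop n] with N hN
  rw [primeWords, Nat.mem_factoredNumbers_iff_primeFactors_subset]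
  refine ⟨hn, fun p hp => ?_⟩
  have hp' := Nat.prime_of_mem_primeFactors hp
  rw [Finset.mem_image]
  refine ⟨Nat.count Nat.Prime p, ?_, Nat.nth_count hp'⟩
  rw [Finset.mem_range]
  -- The index of `p` among the primes is at most `p`, and `p ≤ n < N`.
  exact ((Nat.count_le (p := Nat.Prime) (n := p)).trans (Nat.le_of_mem_primeFactors hp)).trans_lt hN

namespace DirichletHilbert

variable {w : ArithmeticFunction ℝ} {hw : ∀ n : ℕ, n ≠ 0 → 0 < w n} {σ₀ : ℝ} {φ : ℂ → ℂ}

theorem supOnHalfPlane_proj_le (hσ₀ : WeightCondition w σ₀) {Δ : ℝ}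
    (hΔ : ProjectedWeightCondition w Δ) {Φ : DirichletHilbert w hw} (hΦ : Φ.Represents φ σ₀)
    {M : DirichletHilbert w hw →L[ℂ] DirichletHilbert w hw}
    (hM : IsMultiplicationOperator φ σ₀ M) (N : ℕ) :
    supOnHalfPlane (proj w hw N Φ).eval Δ ≤ ‖M‖ₑ :=
  iSup₂_le fun _ hs => enorm_le_iff_norm_le.mpr (norm_eval_proj_le hσ₀ hΔ hΦ hM N hs)

theorem exists_analyticContinuation (hσ₀ : WeightCondition w σ₀) {Δ : ℝ}
    (hΔ : ProjectedWeightCondition w Δ) {Φ : DirichletHilbert w hw} (hΦ : Φ.Represents φ σ₀)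
    {M : DirichletHilbert w hw →L[ℂ] DirichletHilbert w hw}
    (hM : IsMultiplicationOperator φ σ₀ M) :
    ∃ ψ : ℂ → ℂ, IsAnalyticContinuation φ σ₀ ψ Δ ∧
      (∀ s ∈ halfPlane Δ, DirichletConvergesTo Φ.coeff s (ψ s)) ∧
      supOnHalfPlane ψ Δ ≤ ‖M‖ₑ := by
  obtain ⟨ψ, h1, h2, h3⟩ := exists_bounded_sum_of_eventually_eq (a := Φ.coeff)
    (b := fun N => (proj w hw N Φ).coeff) (Δ := Δ) (B := ‖M‖)
    (fun N => absConvergesOn_of_mem_projSubspace hΔ (Submodule.starProjection_apply_mem _ Φ))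
    (fun N s hs => norm_eval_proj_le hσ₀ hΔ hΦ hM N hs) (fun n => by
      rcases eq_or_ne n 0 with rfl | hn
      · simp
      filter_upwards [eventually_mem_primeWords hn] with N hN
      rw [coeff_proj, Set.indicator_of_mem hN])
  refine ⟨ψ, ⟨h1, fun s hs => ?_⟩, h2, iSup₂_le fun s hs => enorm_le_iff_norm_le.mpr (h3 s hs)⟩
  exact tendsto_nhds_unique (h2 s hs.1) (hΦ s hs.2).dirichletConvergesTo

end DirichletHilbert

/-! ### Mean values along vertical lines. -/

section Means

/-- `G` has mean value `L` on the half-line `[0, ∞)`. -/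
def HasMean (G : ℝ → ℂ) (L : ℂ) : Prop :=
  Tendsto (fun T : ℝ => (T : ℂ)⁻¹ * ∫ t in (0 : ℝ)..T, G t) atTop (𝓝 L)

theorem HasMean.const_mul {G : ℝ → ℂ} {L : ℂ} (h : HasMean G L) (c : ℂ) :
    HasMean (fun t => c * G t) (c * L) := by
  refine (Tendsto.const_mul c h).congr fun T => ?_
  rw [intervalIntegral.integral_const_mul]
  ring

theorem HasMean.sum {ι : Type*} {D : Finset ι} {G : ι → ℝ → ℂ} {L : ι → ℂ}
    (hG : ∀ i ∈ D, Continuous (G i)) (h : ∀ i ∈ D, HasMean (G i) (L i)) :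
    HasMean (fun t => ∑ i ∈ D, G i t) (∑ i ∈ D, L i) := by
  refine (tendsto_finsetSum D h).congr fun T => ?_
  rw [intervalIntegral.integral_finsetSum fun i hi => (hG i hi).intervalIntegrable _ _,
    Finset.mul_sum]

theorem HasMean.norm_le {G H : ℝ → ℂ} {L : ℂ} {K : ℝ} (hG : HasMean G L) (hH : HasMean H K)
    (hHc : Continuous H) (hle : ∀ t, ‖G t‖ ≤ (H t).re) : ‖L‖ ≤ K := by
  have h2 : Tendsto (fun T : ℝ => ((T : ℂ)⁻¹ * ∫ t in (0 : ℝ)..T, H t).re) atTop (𝓝 K) := by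
    have := (Complex.continuous_re.tendsto _).comp hH
    rwa [Complex.ofReal_re] at this
  refine le_of_tendsto_of_tendsto hG.norm h2 ?_
  filter_upwards [eventually_gt_atTop 0] with T hT
  have h3 : (∫ t in (0 : ℝ)..T, H t).re = ∫ t in (0 : ℝ)..T, (H t).re := by
    exact (Complex.reCLM.intervalIntegral_comp_comm
      (hHc.intervalIntegrable (μ := MeasureTheory.volume) 0 T)).symm
  rw [norm_mul, norm_inv, Complex.norm_real, Real.norm_of_nonneg hT.le, ← Complex.ofReal_inv,
    Complex.re_ofReal_mul, h3]
  refine mul_le_mul_of_nonneg_left ?_ (by positivity)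
  exact intervalIntegral.norm_integral_le_of_norm_le hT.le (MeasureTheory.ae_of_all _ fun t _ => hle t)
    ((Complex.continuous_re.comp hHc).intervalIntegrable _ _)

theorem integral_exp_mul_I {θ : ℝ} (hθ : θ ≠ 0) (T : ℝ) :
    ∫ t in (0 : ℝ)..T, Complex.exp (θ * Complex.I * t) =
      (Complex.exp (θ * Complex.I * T) - 1) / (θ * Complex.I) := by
  have hc : (θ : ℂ) * Complex.I ≠ 0 :=
    mul_ne_zero (Complex.ofReal_ne_zero.mpr hθ) Complex.I_ne_zero
  simpa using integral_exp_mul_complex (a := 0) (b := T) hc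

theorem hasMean_exp (θ : ℝ) :
    HasMean (fun t => Complex.exp (θ * Complex.I * t)) (if θ = 0 then 1 else 0) := by
  split_ifs with hθ
  · refine tendsto_const_nhds.congr' ?_
    filter_upwards [eventually_gt_atTop 0] with T hT
    have : (T : ℂ) ≠ 0 := Complex.ofReal_ne_zero.mpr hT.ne'
    simp [hθ, this]
  -- For `θ ≠ 0` the integral stays bounded by `2 / |θ|`.
  · refine squeeze_zero_norm' (a := fun T : ℝ => T⁻¹ * (2 / |θ|)) ?_ ?_
    · filter_upwards [eventually_gt_atTop 0] with T hT
      rw [integral_exp_mul_I hθ, norm_mul, norm_inv, Complex.norm_real,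
        Real.norm_of_nonneg hT.le]
      refine mul_le_mul_of_nonneg_left ?_ (by positivity)
      rw [norm_div, norm_mul, Complex.norm_I, mul_one, Complex.norm_real, Real.norm_eq_abs]
      gcongr
      refine (norm_sub_le _ _).trans_eq ?_
      rw [show (θ : ℂ) * Complex.I * T = ((θ * T : ℝ) : ℂ) * Complex.I by push_cast; ring,
        Complex.norm_exp_ofReal_mul_I, norm_one]
      norm_num
    · simpa using tendsto_inv_atTop_zero.mul_const (2 / |θ|)

theorem norm_mean_exp_le (θ : ℝ) {T : ℝ} (hT : 0 < T) :
    ‖(T : ℂ)⁻¹ * ∫ t in (0 : ℝ)..T, Complex.exp (θ * Complex.I * t)‖ ≤ 1 := by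
  have h : ‖∫ t in (0 : ℝ)..T, Complex.exp (θ * Complex.I * t)‖ ≤ 1 * |T - 0| := by
    refine intervalIntegral.norm_integral_le_of_norm_le_const fun t _ => ?_
    rw [show (θ : ℂ) * Complex.I * t = ((θ * t : ℝ) : ℂ) * Complex.I by push_cast; ring,
      Complex.norm_exp_ofReal_mul_I]
  rw [one_mul, sub_zero, abs_of_pos hT] at h
  rw [norm_mul, norm_inv, Complex.norm_real, Real.norm_of_nonneg hT.le, inv_mul_le_iff₀ hT, mul_one]
  exact h

/-- The point `σ + it`. -/
noncomputable def linePoint (σ t : ℝ) : ℂ := σ + t * Complex.I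

@[simp] theorem linePoint_re (σ t : ℝ) : (linePoint σ t).re = σ := by simp [linePoint]

theorem continuous_linePoint (σ : ℝ) : Continuous (linePoint σ) := by
  unfold linePoint
  fun_prop

theorem linePoint_mem {δ σ : ℝ} (h : δ < σ) (t : ℝ) : linePoint σ t ∈ halfPlane δ := by
  simpa [halfPlane] using h

theorem term_mul_cpow (a : ℕ → ℂ) {n : ℕ} (hn : n ≠ 0) {x : ℝ} (hx : 0 < x) (σ t : ℝ) :
    LSeries.term a (linePoint σ t) n * (x : ℂ) ^ linePoint σ t =
      LSeries.term a σ n * (x : ℂ) ^ (σ : ℂ) *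
        Complex.exp ((Real.log x - Real.log n : ℝ) * Complex.I * t) := by
  have hn0 : (n : ℂ) ≠ 0 := by exact_mod_cast hn
  have hx0 : (x : ℂ) ≠ 0 := by exact_mod_cast hx.ne'
  rw [LSeries.term_of_ne_zero hn, LSeries.term_of_ne_zero hn, linePoint, Complex.cpow_add _ _ hn0,
    Complex.cpow_add _ _ hx0, Complex.cpow_def_of_ne_zero hn0 (t * Complex.I),
    Complex.cpow_def_of_ne_zero hx0 (t * Complex.I), ← Complex.natCast_log, ← Complex.ofReal_log hx.le,
    div_mul_eq_div_div, div_eq_mul_inv _ (Complex.exp _), ← Complex.exp_neg]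
  calc _ = a n / (n : ℂ) ^ (σ : ℂ) * (x : ℂ) ^ (σ : ℂ) *
        (Complex.exp (-(Real.log n * (t * Complex.I))) *
          Complex.exp (Real.log x * (t * Complex.I))) := by ring
    _ = _ := by
      rw [← Complex.exp_add]
      congr 2
      push_cast
      ring

/-- The mean of `x^s ∑ aₙ n^(-s)` along a vertical line of absolute convergence. -/
theorem hasMean_LSeries {a : ℕ → ℂ} {σ : ℝ} (ha : LSeriesSummable a σ) {x : ℝ} (hx : 0 < x) :
    HasMean (fun t => LSeries a (linePoint σ t) * (x : ℂ) ^ linePoint σ t)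
      (∑' n : ℕ, if (n : ℝ) = x then a n else 0) := by
  set b : ℕ → ℂ := fun n => LSeries.term a σ n * (x : ℂ) ^ (σ : ℂ) with hb
  have hbs : Summable fun n => ‖b n‖ := (ha.mul_right ((x : ℂ) ^ (σ : ℂ))).norm
  set e : ℕ → ℝ → ℂ := fun n t =>
    Complex.exp ((Real.log x - Real.log n : ℝ) * Complex.I * t) with he
  have hen : ∀ n t, ‖e n t‖ = 1 := fun n t => by
    simp only [he]
    rw [show ((Real.log x - Real.log n : ℝ) : ℂ) * Complex.I * t =
      (((Real.log x - Real.log n) * t : ℝ) : ℂ) * Complex.I by push_cast; ring,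
      Complex.norm_exp_ofReal_mul_I]
  have hterm : ∀ n t, LSeries.term a (linePoint σ t) n * (x : ℂ) ^ linePoint σ t = b n * e n t := by
    intro n t
    rcases eq_or_ne n 0 with rfl | hn
    · simp [hb]
    · exact term_mul_cpow a hn hx σ t
  have hfun : ∀ t, HasSum (fun n => b n * e n t)
      (LSeries a (linePoint σ t) * (x : ℂ) ^ linePoint σ t) := by
    intro t
    have : LSeriesSummable a (linePoint σ t) := ha.of_re_le_re (by simp)
    have := this.hasSum.mul_right ((x : ℂ) ^ linePoint σ t)
    simp only [hterm] at this
    exact this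
  have hint : ∀ T : ℝ, (∫ t in (0 : ℝ)..T, LSeries a (linePoint σ t) * (x : ℂ) ^ linePoint σ t) =
      ∑' n, b n * ∫ t in (0 : ℝ)..T, e n t := by
    intro T
    have := intervalIntegral.hasSum_integral_of_dominated_convergence (a := 0) (b := T)
      (μ := MeasureTheory.volume)
      (F := fun n t => b n * e n t) (fun n _ => ‖b n‖)
      (fun n => (Continuous.aestronglyMeasurable (by fun_prop)))
      (fun n => MeasureTheory.ae_of_all _ fun t _ => by rw [norm_mul, hen, mul_one])
      (MeasureTheory.ae_of_all _ fun t _ => hbs) intervalIntegrable_const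
      (MeasureTheory.ae_of_all _ fun t _ => hfun t)
    rw [← this.tsum_eq]
    simp only [intervalIntegral.integral_const_mul]
  -- Only the zero frequency `log n = log x` survives. The index `0`, where `Real.log 0 = 0`, is
  -- harmless because `b 0 = 0`.
  have hlim : Tendsto (fun T : ℝ => ∑' n, b n * ((T : ℂ)⁻¹ * ∫ t in (0 : ℝ)..T, e n t)) atTop
      (𝓝 (∑' n : ℕ, if (n : ℝ) = x then a n else 0)) := by
    refine tendsto_tsum_of_dominated_convergence hbs (fun n => ?_) ?_
    · rcases eq_or_ne n 0 with rfl | hn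
      · simp [hb, hx.ne]
      have h2 := Tendsto.const_mul (b n) (hasMean_exp (Real.log x - Real.log n))
      have hn0 : (0 : ℝ) < n := by positivity
      have h3 : b n * (if Real.log x - Real.log n = 0 then 1 else 0) =
          if (n : ℝ) = x then a n else 0 := by
        by_cases h : (n : ℝ) = x
        · have hx0 : (n : ℂ) ^ (σ : ℂ) ≠ 0 := by
            simp [Complex.cpow_eq_zero_iff, hn]
          rw [if_pos (by rw [h, sub_self]), if_pos h, mul_one, hb]
          simp only
          rw [LSeries.term_of_ne_zero hn, ← h, Complex.ofReal_natCast, div_mul_cancel₀ _ hx0]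
        · rw [if_neg h, if_neg, mul_zero]
          rw [sub_eq_zero]
          exact fun h' => h (Real.log_injOn_pos hn0 hx h'.symm)
      rw [h3] at h2
      exact h2
    · filter_upwards [eventually_gt_atTop 0] with T hT n
      rw [norm_mul]
      exact mul_le_of_le_one_right (norm_nonneg _) (norm_mean_exp_le _ hT)
  refine hlim.congr fun T => ?_
  rw [hint, ← tsum_mul_left]
  exact tsum_congr fun n => by ring

variable {ψ : ℂ → ℂ} {δ C : ℝ}

/-- For bounded analytic functions, the means along vertical lines do not depend on the line. -/
theorem HasMean.shift (hψ : DifferentiableOn ℂ ψ (halfPlane δ))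
    (hC : ∀ s ∈ halfPlane δ, ‖ψ s‖ ≤ C) {x : ℝ} (hx : 0 < x) {σ σ₁ : ℝ} (hσ : δ < σ) (hσ₁ : σ ≤ σ₁)
    {L : ℂ} (h : HasMean (fun t => ψ (linePoint σ₁ t) * (x : ℂ) ^ linePoint σ₁ t) L) :
    HasMean (fun t => ψ (linePoint σ t) * (x : ℂ) ^ linePoint σ t) L := by
  have hx0 : (x : ℂ) ≠ 0 := by exact_mod_cast hx.ne'
  have hC0 : 0 ≤ C := (norm_nonneg _).trans (hC _ (linePoint_mem hσ 0))
  set f : ℂ → ℂ := fun s => ψ s * (x : ℂ) ^ s with hf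
  have hfd : DifferentiableOn ℂ f (halfPlane δ) :=
    hψ.mul (differentiable_id.const_cpow (Or.inl hx0)).differentiableOn
  set K : ℝ := C * (x ^ σ + x ^ σ₁) with hK
  have hbound : ∀ y T : ℝ, y ∈ Set.uIoc σ σ₁ → ‖f (y + T * Complex.I)‖ ≤ K := by
    intro y T hy
    rw [Set.uIoc_of_le hσ₁] at hy
    have hmem : (y + T * Complex.I : ℂ) ∈ halfPlane δ := linePoint_mem (hσ.trans hy.1) T
    rw [hf, hK]
    simp only [norm_mul]
    refine mul_le_mul (hC _ hmem) ?_ (norm_nonneg _) hC0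
    rw [Complex.norm_cpow_eq_rpow_re_of_pos hx]
    have hre : (y + T * Complex.I : ℂ).re = y := by simp
    rw [hre]
    have p1 : 0 ≤ x ^ σ := by positivity
    have p2 : 0 ≤ x ^ σ₁ := by positivity
    -- The power `x^y` is monotone in `y`, increasing or decreasing with `x`. The sum of its two
    -- endpoint values in `K` covers both cases.
    rcases le_total 1 x with h1 | h1
    · linarith [Real.rpow_le_rpow_of_exponent_le h1 hy.2]
    · linarith [Real.rpow_le_rpow_of_exponent_ge hx h1 hy.1.le]
  -- Cauchy's theorem on a rectangle of height `T`. The horizontal sides are bounded independently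
  -- of `T`, so they disappear after division by `T`.
  have hrect : ∀ T : ℝ, (∫ t in (0 : ℝ)..T, f (linePoint σ₁ t)) -
      (∫ t in (0 : ℝ)..T, f (linePoint σ t)) =
      Complex.I * ((∫ y in σ..σ₁, f (y + (0 : ℝ) * Complex.I)) -
        ∫ y in σ..σ₁, f (y + T * Complex.I)) := by
    intro T
    have := Complex.integral_boundary_rect_eq_zero_of_differentiableOn f (linePoint σ 0)
      (linePoint σ₁ T) (hfd.mono fun z hz => by
        have := (Complex.mem_reProdIm.mp hz).1
        rw [linePoint_re, linePoint_re, Set.uIcc_of_le hσ₁] at this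
        exact hσ.trans_le this.1)
    have him : ∀ s t : ℝ, (linePoint s t).im = t := fun s t => by simp [linePoint]
    simp only [linePoint_re, him, smul_eq_mul] at this
    simp only [linePoint]
    linear_combination (-Complex.I) * this +
      ((∫ t in (0 : ℝ)..T, f (σ₁ + t * Complex.I)) -
        (∫ t in (0 : ℝ)..T, f (σ + t * Complex.I))) * Complex.I_sq
  have hdiff : Tendsto (fun T : ℝ => (T : ℂ)⁻¹ * ((∫ t in (0 : ℝ)..T, f (linePoint σ₁ t)) -
      (∫ t in (0 : ℝ)..T, f (linePoint σ t)))) atTop (𝓝 0) := by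
    refine squeeze_zero_norm' (a := fun T : ℝ => T⁻¹ * (2 * (K * |σ₁ - σ|))) ?_ ?_
    · filter_upwards [eventually_gt_atTop 0] with T hT
      rw [hrect, norm_mul, norm_inv, Complex.norm_real, Real.norm_of_nonneg hT.le, norm_mul,
        Complex.norm_I, one_mul]
      refine mul_le_mul_of_nonneg_left ((norm_sub_le _ _).trans ?_) (by positivity)
      rw [two_mul]
      exact add_le_add
        (intervalIntegral.norm_integral_le_of_norm_le_const fun y hy => hbound y 0 hy)
        (intervalIntegral.norm_integral_le_of_norm_le_const fun y hy => hbound y T hy)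
    · simpa using tendsto_inv_atTop_zero.mul_const (2 * (K * |σ₁ - σ|))
  have := Tendsto.sub h hdiff
  rw [sub_zero] at this
  refine this.congr fun T => ?_
  simp only [hf]
  ring

/-- The mean is computed far to the right, where the series converges absolutely, and carried back
to `σ`. -/
theorem hasMean_of_analyticContinuation (hψ : DifferentiableOn ℂ ψ (halfPlane δ))
    (hC : ∀ s ∈ halfPlane δ, ‖ψ s‖ ≤ C) {a : ℕ → ℂ} {σ₀ : ℝ}
    (ha : ∀ s ∈ halfPlane σ₀, LSeriesSummable a s)
    (haψ : ∀ s ∈ halfPlane δ ∩ halfPlane σ₀, ψ s = LSeries a s) {σ : ℝ} (hσ : δ < σ)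
    {x : ℝ} (hx : 0 < x) :
    HasMean (fun t => ψ (linePoint σ t) * (x : ℂ) ^ linePoint σ t)
      (∑' n : ℕ, if (n : ℝ) = x then a n else 0) := by
  set σ₁ := max σ (σ₀ + 1)
  have h0 : σ₀ < σ₁ := (lt_add_one σ₀).trans_le (le_max_right _ _)
  refine HasMean.shift hψ hC hx hσ (le_max_left σ (σ₀ + 1)) ?_
  have h1 : LSeriesSummable a (σ₁ : ℂ) := ha _ (by simpa [halfPlane] using h0)
  have h2 := hasMean_LSeries h1 hx
  refine h2.congr fun T => ?_
  congr 1
  refine intervalIntegral.integral_congr fun t _ => ?_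
  rw [haψ _ ⟨linePoint_mem (hσ.trans_le (le_max_left _ _)) t, linePoint_mem h0 t⟩]

end Means

/-! ### The norm inequality for the weights `n^(-2δ)` on the divisors of `J`. -/

section CoefficientInequality

/-- The Dirichlet polynomial `∑_{j ∈ D} f_j j^(-s)`. -/
noncomputable def dirichletPoly (D : Finset ℕ) (f : ℕ → ℂ) (s : ℂ) : ℂ :=
  ∑ j ∈ D, f j * (j : ℂ) ^ (-s)

variable {D : Finset ℕ}

theorem continuous_dirichletPoly (hD : ∀ n ∈ D, n ≠ 0) (f : ℕ → ℂ) (σ : ℝ) :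
    Continuous fun t => dirichletPoly D f (linePoint σ t) := by
  unfold dirichletPoly
  refine continuous_finsetSum _ fun j hj => continuous_const.mul ?_
  exact (continuous_linePoint σ).neg.const_cpow (Or.inl (by exact_mod_cast hD j hj))

/-- On the line `Re s = σ` one has `conj s = 2σ - s`, so the conjugate is again analytic in `s`. -/
theorem cpow_mul_conj_cpow {j k : ℕ} (hj : j ≠ 0) (hk : k ≠ 0) (σ t : ℝ) :
    (j : ℂ) ^ (-linePoint σ t) * (starRingEnd ℂ) ((k : ℂ) ^ (-linePoint σ t)) =
      (((k : ℝ) / j : ℝ) : ℂ) ^ linePoint σ t * (((k : ℝ) ^ (-2 * σ) : ℝ) : ℂ) := by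
  have hj0 : (j : ℂ) ≠ 0 := by exact_mod_cast hj
  have hk0 : (k : ℂ) ≠ 0 := by exact_mod_cast hk
  have hjp : (j : ℂ) ^ linePoint σ t ≠ 0 := by simp [Complex.cpow_eq_zero_iff, hj]
  have h1 : (starRingEnd ℂ) ((k : ℂ) ^ (-linePoint σ t)) =
      (k : ℂ) ^ linePoint σ t * (((k : ℝ) ^ (-2 * σ) : ℝ) : ℂ) := by
    have hc := Complex.cpow_conj (k : ℂ) (-linePoint σ t)
      (by rw [Complex.natCast_arg]; exact Real.pi_ne_zero.symm)
    rw [Complex.conj_natCast] at hc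
    rw [Complex.ofReal_cpow (by positivity), Complex.ofReal_natCast, ← Complex.cpow_add _ _ hk0,
      ← hc]
    congr 1
    simp only [linePoint, map_neg, map_add, map_mul, Complex.conj_ofReal, Complex.conj_I]
    push_cast
    ring
  have h2 : (((k : ℝ) / j : ℝ) : ℂ) ^ linePoint σ t * (j : ℂ) ^ linePoint σ t =
      (k : ℂ) ^ linePoint σ t := by
    rw [← Complex.ofReal_natCast j, ← Complex.mul_cpow_ofReal_nonneg (by positivity) (by positivity),
      ← Complex.ofReal_mul, div_mul_cancel₀ _ (by exact_mod_cast hj), Complex.ofReal_natCast]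
  rw [h1, ← h2, Complex.cpow_neg]
  field_simp

variable {ψ : ℂ → ℂ} {δ C σ₀ σ : ℝ} {a : ℕ → ℂ}

/-- The coefficient of `x^(-s)` in the Dirichlet series `∑ aₙ n^(-s)`. -/
noncomputable def coeffAt (a : ℕ → ℂ) (x : ℝ) : ℂ := ∑' n : ℕ, if (n : ℝ) = x then a n else 0

theorem coeffAt_div (a : ℕ → ℂ) {j : ℕ} (hj : j ≠ 0) (k : ℕ) :
    coeffAt a ((k : ℝ) / j) = if j ∣ k then a (k / j) else 0 := by
  have hj0 : (j : ℝ) ≠ 0 := by exact_mod_cast hj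
  have hiff : ∀ n : ℕ, (n : ℝ) = (k : ℝ) / j ↔ n * j = k := fun n => by
    rw [eq_div_iff hj0]
    exact_mod_cast Iff.rfl
  unfold coeffAt
  simp only [hiff]
  split_ifs with h
  · obtain ⟨m, rfl⟩ := h
    rw [tsum_eq_single m, if_pos (mul_comm _ _), Nat.mul_div_cancel_left _ (Nat.pos_of_ne_zero hj)]
    intro n hn
    refine if_neg fun h => hn ?_
    rw [mul_comm] at h
    exact Nat.eq_of_mul_eq_mul_left (Nat.pos_of_ne_zero hj) h
  · refine (tsum_congr fun n => if_neg fun h' => h ?_).trans tsum_zero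
    exact ⟨n, by rw [← h', mul_comm]⟩

/-- Expanding both polynomials leaves the means of `ψ(s) (k/j)^s`. Each of these is the coefficient
of `a` at `k/j`, zero unless `j ∣ k`. -/
theorem hasMean_mul_dirichletPoly (hψ : DifferentiableOn ℂ ψ (halfPlane δ))
    (hC : ∀ s ∈ halfPlane δ, ‖ψ s‖ ≤ C) (ha : ∀ s ∈ halfPlane σ₀, LSeriesSummable a s)
    (haψ : ∀ s ∈ halfPlane δ ∩ halfPlane σ₀, ψ s = LSeries a s) (hσ : δ < σ)
    (hD : ∀ n ∈ D, n ≠ 0) (f q : ℕ → ℂ) :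
    HasMean (fun t => ψ (linePoint σ t) * dirichletPoly D f (linePoint σ t) *
        (starRingEnd ℂ) (dirichletPoly D q (linePoint σ t)))
      (∑ k ∈ D, (∑ j ∈ D, coeffAt a ((k : ℝ) / j) * f j) * (starRingEnd ℂ) (q k) *
        (((k : ℝ) ^ (-2 * σ) : ℝ) : ℂ)) := by
  have hcont : Continuous fun t => ψ (linePoint σ t) :=
    hψ.continuousOn.comp_continuous (continuous_linePoint σ) fun t => linePoint_mem hσ t
  have hpos : ∀ k ∈ D, ∀ j ∈ D, (0 : ℝ) < (k : ℝ) / j := fun k hk j hj => by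
    have := Nat.pos_of_ne_zero (hD k hk)
    have := Nat.pos_of_ne_zero (hD j hj)
    positivity
  have key := HasMean.sum (D := D)
    (G := fun k t => ∑ j ∈ D, (f j * (starRingEnd ℂ) (q k) * (((k : ℝ) ^ (-2 * σ) : ℝ) : ℂ)) *
      (ψ (linePoint σ t) * (((k : ℝ) / j : ℝ) : ℂ) ^ linePoint σ t))
    (L := fun k => ∑ j ∈ D, (f j * (starRingEnd ℂ) (q k) * (((k : ℝ) ^ (-2 * σ) : ℝ) : ℂ)) *
      coeffAt a ((k : ℝ) / j))
  have hc : ∀ k ∈ D, ∀ j ∈ D, Continuous fun t =>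
      (f j * (starRingEnd ℂ) (q k) * (((k : ℝ) ^ (-2 * σ) : ℝ) : ℂ)) *
      (ψ (linePoint σ t) * (((k : ℝ) / j : ℝ) : ℂ) ^ linePoint σ t) := fun k hk j hj =>
    continuous_const.mul (hcont.mul ((continuous_linePoint σ).const_cpow
      (Or.inl (Complex.ofReal_ne_zero.mpr (hpos k hk j hj).ne'))))
  specialize key (fun k hk => continuous_finsetSum _ (hc k hk)) (fun k hk =>
    HasMean.sum (hc k hk) fun j hj =>
      (hasMean_of_analyticContinuation hψ hC ha haψ hσ (hpos k hk j hj)).const_mul _)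
  convert! key using 1
  · ext t
    rw [dirichletPoly, dirichletPoly, map_sum, Finset.mul_sum]
    refine Finset.sum_congr rfl fun k hk => ?_
    rw [Finset.mul_sum, Finset.sum_mul]
    refine Finset.sum_congr rfl fun j hj => ?_
    rw [map_mul]
    linear_combination (ψ (linePoint σ t) * f j * (starRingEnd ℂ) (q k)) *
      cpow_mul_conj_cpow (hD j hj) (hD k hk) σ t
  · refine Finset.sum_congr rfl fun k _ => ?_
    rw [Finset.sum_mul, Finset.sum_mul]
    refine Finset.sum_congr rfl fun j _ => by ring

/-- **Carlson's identity** for Dirichlet polynomials. -/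
theorem hasMean_norm_sq_dirichletPoly (hD : ∀ n ∈ D, n ≠ 0) (f : ℕ → ℂ) (σ : ℝ) :
    HasMean (fun t => ((‖dirichletPoly D f (linePoint σ t)‖ ^ 2 : ℝ) : ℂ))
      ((∑ k ∈ D, ‖f k‖ ^ 2 * (k : ℝ) ^ (-2 * σ) : ℝ) : ℂ) := by
  have h := hasMean_mul_dirichletPoly (ψ := fun _ => 1) (δ := σ - 1) (C := 1) (σ₀ := 0) (σ := σ)
    (a := LSeries.delta) (D := D) (differentiableOn_const _) (by simp)
    (fun s _ => by
      refine summable_of_ne_finset_zero (s := {1}) fun n hn => ?_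
      rw [LSeries.term_delta, if_neg (by simpa using hn)]) (by simp [LSeries_delta]) (by linarith) hD f f
  convert! h using 1
  · ext t
    rw [one_mul, Complex.mul_conj, Complex.normSq_eq_norm_sq]
  · push_cast
    refine Finset.sum_congr rfl fun k hk => ?_
    congr 1
    rw [Finset.sum_eq_single_of_mem k hk, coeffAt_div _ (hD k hk), if_pos dvd_rfl,
      Nat.div_self (Nat.pos_of_ne_zero (hD k hk)), LSeries.delta, if_pos rfl, one_mul,
      Complex.mul_conj, Complex.normSq_eq_norm_sq]
    · push_cast
      rfl
    · intro j hj hjk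
      rw [coeffAt_div _ (hD j hj)]
      split_ifs with hdvd
      · rw [LSeries.delta, if_neg, zero_mul]
        intro h1
        exact hjk (Nat.eq_of_dvd_of_div_eq_one hdvd h1)
      · rw [zero_mul]

/-- A bounded Dirichlet series acts contractively on the coefficients at the divisors of `J`. -/
theorem sum_divisors_norm_mul_sq_le_of_lt (hψ : DifferentiableOn ℂ ψ (halfPlane δ))
    (hC : ∀ s ∈ halfPlane δ, ‖ψ s‖ ≤ C) {a g : ArithmeticFunction ℂ}
    (ha : ∀ s ∈ halfPlane σ₀, LSeriesSummable a s)
    (haψ : ∀ s ∈ halfPlane δ ∩ halfPlane σ₀, ψ s = LSeries a s) (hσ : δ < σ) {J : ℕ} (hJ : J ≠ 0) :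
    ∑ k ∈ J.divisors, ‖(a * g) k‖ ^ 2 * (k : ℝ) ^ (-2 * σ) ≤
      C ^ 2 * ∑ k ∈ J.divisors, ‖g k‖ ^ 2 * (k : ℝ) ^ (-2 * σ) := by
  have hD : ∀ n ∈ J.divisors, n ≠ 0 := fun n hn => (Nat.pos_of_mem_divisors hn).ne'
  -- All divisors of `k ∣ J` divide `J`, so truncating `g` to the divisors of `J` loses nothing in
  -- these coefficients.
  have hconv : ∀ k ∈ J.divisors,
      ∑ j ∈ J.divisors, coeffAt a ((k : ℝ) / j) * g j = (a * g) k := by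
    intro k hk
    rw [ArithmeticFunction.mul_apply, Nat.sum_divisorsAntidiagonal' fun x y => a x * g y]
    have hdiv : k.divisors = J.divisors.filter (· ∣ k) := by
      ext j
      simp only [Nat.mem_divisors, Finset.mem_filter]
      have hk' := Nat.mem_divisors.mp hk
      exact ⟨fun h => ⟨⟨h.1.trans hk'.1, hJ⟩, h.1⟩, fun h => ⟨h.2, hD k hk⟩⟩
    rw [hdiv, Finset.sum_filter]
    refine Finset.sum_congr rfl fun j hj => ?_
    rw [coeffAt_div _ (hD j hj), ite_mul, zero_mul]
  set X : ℝ := ∑ k ∈ J.divisors, ‖(a * g) k‖ ^ 2 * (k : ℝ) ^ (-2 * σ) with hX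
  set Y : ℝ := ∑ k ∈ J.divisors, ‖g k‖ ^ 2 * (k : ℝ) ^ (-2 * σ)
  -- Testing against `a * g` itself makes the mean equal to `X`. The pointwise bound `2CPQ ≤ C²P² +
  -- Q²` then gives `2X ≤ C²Y + X`.
  have h1 := hasMean_mul_dirichletPoly hψ hC ha haψ hσ hD g ⇑(a * g)
  have hL : (∑ k ∈ J.divisors, (∑ j ∈ J.divisors, coeffAt a ((k : ℝ) / j) * g j) *
      (starRingEnd ℂ) ((a * g) k) * (((k : ℝ) ^ (-2 * σ) : ℝ) : ℂ)) = (X : ℂ) := by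
    rw [hX]
    push_cast
    refine Finset.sum_congr rfl fun k hk => ?_
    rw [hconv k hk, Complex.mul_conj, Complex.normSq_eq_norm_sq]
    push_cast
    rfl
  rw [hL] at h1
  set P : ℝ → ℝ := fun t => ‖dirichletPoly J.divisors g (linePoint σ t)‖
  set Q : ℝ → ℝ := fun t => ‖dirichletPoly J.divisors ⇑(a * g) (linePoint σ t)‖
  have hPc : Continuous P := (continuous_dirichletPoly hD g σ).norm
  have hQc : Continuous Q := (continuous_dirichletPoly hD ⇑(a * g) σ).norm
  have h2 : HasMean (fun t => ((C ^ 2 * P t ^ 2 + Q t ^ 2 : ℝ) : ℂ)) ((C ^ 2 * Y + X : ℝ) : ℂ) := by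
    have := HasMean.sum (D := Finset.univ) (ι := Fin 2)
      (G := ![fun t => ((C ^ 2 : ℝ) : ℂ) * ((P t ^ 2 : ℝ) : ℂ), fun t => ((Q t ^ 2 : ℝ) : ℂ)])
      (L := ![((C ^ 2 : ℝ) : ℂ) * (Y : ℂ), (X : ℂ)])
      (by
        intro i _
        fin_cases i
        · change Continuous fun t => ((C ^ 2 : ℝ) : ℂ) * ((P t ^ 2 : ℝ) : ℂ)
          fun_prop
        · change Continuous fun t => ((Q t ^ 2 : ℝ) : ℂ)
          fun_prop)
      (by
        intro i _
        fin_cases i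
        · exact (hasMean_norm_sq_dirichletPoly hD g σ).const_mul _
        · exact hasMean_norm_sq_dirichletPoly hD ⇑(a * g) σ)
    simpa [Fin.sum_univ_two] using this
  have h3 := (h1.const_mul 2).norm_le h2 (by fun_prop) fun t => by
    rw [Complex.ofReal_re, norm_mul, norm_mul, norm_mul, RCLike.norm_conj, Complex.norm_two]
    have hb := hC _ (linePoint_mem hσ t)
    have hP : 0 ≤ P t := norm_nonneg _
    have hQ : 0 ≤ Q t := norm_nonneg _
    have : ‖ψ (linePoint σ t)‖ * P t * Q t ≤ C * P t * Q t := by gcongr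
    change 2 * (‖ψ (linePoint σ t)‖ * P t * Q t) ≤ _
    nlinarith [sq_nonneg (C * P t - Q t)]
  have hX0 : 0 ≤ X := Finset.sum_nonneg fun k _ => by positivity
  rw [norm_mul, Complex.norm_two, Complex.norm_real, Real.norm_of_nonneg hX0] at h3
  linarith

theorem sum_divisors_norm_mul_sq_le (hψ : DifferentiableOn ℂ ψ (halfPlane δ))
    (hC : ∀ s ∈ halfPlane δ, ‖ψ s‖ ≤ C) {a g : ArithmeticFunction ℂ}
    (ha : ∀ s ∈ halfPlane σ₀, LSeriesSummable a s)
    (haψ : ∀ s ∈ halfPlane δ ∩ halfPlane σ₀, ψ s = LSeries a s) {J : ℕ} (hJ : J ≠ 0) :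
    ∑ k ∈ J.divisors, ‖(a * g) k‖ ^ 2 * (k : ℝ) ^ (-2 * δ) ≤
      C ^ 2 * ∑ k ∈ J.divisors, ‖g k‖ ^ 2 * (k : ℝ) ^ (-2 * δ) := by
  have hcont : ∀ h : ArithmeticFunction ℂ,
      Continuous fun σ : ℝ => ∑ k ∈ J.divisors, ‖h k‖ ^ 2 * (k : ℝ) ^ (-2 * σ) := fun h => by
    refine continuous_finsetSum _ fun k hk => continuous_const.mul ?_
    have : (k : ℝ) ≠ 0 := by exact_mod_cast (Nat.pos_of_mem_divisors hk).ne'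
    exact continuous_const.rpow (continuous_const_mul _) fun _ => Or.inl this
  have hle : ∀ h : ArithmeticFunction ℂ,
      Tendsto (fun σ : ℝ => ∑ k ∈ J.divisors, ‖h k‖ ^ 2 * (k : ℝ) ^ (-2 * σ)) (𝓝[>] δ)
        (𝓝 (∑ k ∈ J.divisors, ‖h k‖ ^ 2 * (k : ℝ) ^ (-2 * δ))) := fun h =>
    ((hcont h).tendsto δ).mono_left nhdsWithin_le_nhds
  refine le_of_tendsto_of_tendsto (hle (a * g)) ((hle g).const_mul (C ^ 2)) ?_
  filter_upwards [self_mem_nhdsWithin] with σ hσ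
  exact sum_divisors_norm_mul_sq_le_of_lt hψ hC ha haψ hσ hJ

end CoefficientInequality

/-! ### Multiplicative decreasing weights as mixtures of divisor indicators. -/

section Mixture

theorem sum_divisors_mul_of_coprime {m n : ℕ} (hmn : m.Coprime n) (F : ℕ → ℕ → ℝ) :
    ∑ d ∈ (m * n).divisors, F (d.gcd m) (d.gcd n) =
      ∑ x ∈ m.divisors, ∑ y ∈ n.divisors, F x y := by
  rw [← Finset.sum_product']
  refine Finset.sum_nbij' (fun d => (d.gcd m, d.gcd n)) (fun x => x.1 * x.2) ?_ ?_ ?_ ?_ ?_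
  · intro d hd
    have h := Nat.mem_divisors.mp hd
    have hm := left_ne_zero_of_mul h.2
    have hn := right_ne_zero_of_mul h.2
    simp [Nat.gcd_dvd_right, hm, hn]
  · rintro ⟨x, y⟩ hxy
    simp only [Finset.mem_product, Nat.mem_divisors] at hxy ⊢
    exact ⟨mul_dvd_mul hxy.1.1 hxy.2.1, mul_ne_zero hxy.1.2 hxy.2.2⟩
  · intro d hd
    have h := (Nat.mem_divisors.mp hd).1
    rw [← hmn.gcd_mul d]
    exact Nat.gcd_eq_left h
  · rintro ⟨x, y⟩ hxy
    simp only [Finset.mem_product, Nat.mem_divisors] at hxy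
    have hx : Nat.Coprime y m := (hmn.coprime_dvd_right hxy.2.1).symm
    have hy : Nat.Coprime x n := hmn.coprime_dvd_left hxy.1.1
    simp only [Prod.mk.injEq]
    rw [hx.gcd_mul_right_cancel x, hy.gcd_mul_left_cancel y]
    exact ⟨Nat.gcd_eq_left hxy.1.1, Nat.gcd_eq_left hxy.2.1⟩
  · intro d _
    rfl

/-- A multiplicative function that decreases along the powers of each prime is, on the divisors of
`J`, a nonnegative combination of the indicators of the sets of divisors of the `d ∣ J`. -/
theorem exists_sum_divisors_eq {v : ℕ → ℝ} (h0 : ∀ n, 0 ≤ v n) (h1 : v 1 = 1)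
    (hmul : ∀ m n : ℕ, m.Coprime n → v (m * n) = v m * v n)
    (hdec : ∀ p k : ℕ, p.Prime → v (p ^ (k + 1)) ≤ v (p ^ k)) (J : ℕ) :
    J ≠ 0 → ∃ c : ℕ → ℝ, (∀ d, 0 ≤ c d) ∧
      ∀ n, n ∣ J → v n = ∑ d ∈ J.divisors, if n ∣ d then c d else 0 := by
  induction J using Nat.recOnPosPrimePosCoprime with
  | zero => exact fun h => absurd rfl h
  | one =>
    refine fun _ => ⟨fun _ => 1, fun _ => zero_le_one, fun n hn => ?_⟩
    rw [Nat.dvd_one.mp hn]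
    simp [h1]
  | prime_pow p m hp hm =>
    intro _
    have hinj : ∀ j, Nat.log p (p ^ j) = j := fun j => Nat.log_pow hp.one_lt j
    -- At `p^j` with `j < m` the coefficient is the drop `v (p^j) - v (p^(j+1))`, and `p^m` receives
    -- the remainder `v (p^m)`, so the sum telescopes. The `max` only secures nonnegativity at
    -- arguments that are not powers of `p`.
    refine ⟨fun d => if Nat.log p d < m then max 0 (v d - v (p * d)) else v d,
      fun d => ?_, fun n hn => ?_⟩
    · dsimp only
      split_ifs
      · exact le_max_left _ _
      · exact h0 d
    · obtain ⟨i, hi, rfl⟩ := (Nat.dvd_prime_pow hp).mp hn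
      rw [Nat.sum_divisors_prime_pow hp]
      simp only [hinj, Nat.pow_dvd_pow_iff_le_right hp.one_lt]
      rw [Finset.sum_range_succ, if_pos hi, if_neg (lt_irrefl m), ← Finset.sum_filter]
      have hfil : (Finset.range m).filter (i ≤ ·) = Finset.Ico i m := by
        ext j
        simp [and_comm]
      rw [hfil]
      have hs : ∀ j ∈ Finset.Ico i m,
          (if j < m then max 0 (v (p ^ j) - v (p * p ^ j)) else v (p ^ j)) =
            v (p ^ j) - v (p ^ (j + 1)) := by
        intro j hj
        rw [if_pos (Finset.mem_Ico.mp hj).2, ← pow_succ',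
          max_eq_right (sub_nonneg.mpr (hdec p j hp))]
      rw [Finset.sum_congr rfl hs]
      have := Finset.sum_Ico_sub (fun j => v (p ^ j)) hi
      rw [show ∑ j ∈ Finset.Ico i m, (v (p ^ j) - v (p ^ (j + 1))) =
        -∑ j ∈ Finset.Ico i m, (v (p ^ (j + 1)) - v (p ^ j)) by
          rw [← Finset.sum_neg_distrib]; exact Finset.sum_congr rfl fun j _ => by ring, this]
      ring
  | coprime a b ha hb hab iha ihb =>
    intro _
    obtain ⟨c₁, hc₁, hv₁⟩ := iha (by omega)
    obtain ⟨c₂, hc₂, hv₂⟩ := ihb (by omega)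
    -- Divisors of `a * b`, and divisibility between them, split along the gcds with `a` and `b`, so
    -- the mixtures multiply.
    refine ⟨fun d => c₁ (d.gcd a) * c₂ (d.gcd b), fun d => mul_nonneg (hc₁ _) (hc₂ _),
      fun n hn => ?_⟩
    have hcop : ∀ d : ℕ, (d.gcd a).Coprime (d.gcd b) := fun d =>
      (hab.coprime_dvd_left (Nat.gcd_dvd_right _ _)).coprime_dvd_right (Nat.gcd_dvd_right _ _)
    have hfac : ∀ d, d ∣ a * b → d.gcd a * d.gcd b = d := fun d hd => by
      rw [← hab.gcd_mul d]
      exact Nat.gcd_eq_left hd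
    have hdvd : ∀ d ∈ (a * b).divisors,
        (n ∣ d ↔ n.gcd a ∣ d.gcd a ∧ n.gcd b ∣ d.gcd b) := by
      intro d hd
      constructor
      · intro h
        exact ⟨Nat.gcd_dvd_gcd_of_dvd_left _ h, Nat.gcd_dvd_gcd_of_dvd_left _ h⟩
      · intro h
        rw [← hfac n hn, ← hfac d (Nat.mem_divisors.mp hd).1]
        exact mul_dvd_mul h.1 h.2
    have hsum : ∀ d ∈ (a * b).divisors,
        (if n ∣ d then c₁ (d.gcd a) * c₂ (d.gcd b) else 0) =
          (fun x y => (if n.gcd a ∣ x then c₁ x else 0) * (if n.gcd b ∣ y then c₂ y else 0))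
            (d.gcd a) (d.gcd b) := by
      intro d hd
      by_cases h₁ : n.gcd a ∣ d.gcd a <;> by_cases h₂ : n.gcd b ∣ d.gcd b <;>
        simp [hdvd d hd, h₁, h₂]
    rw [Finset.sum_congr rfl hsum, sum_divisors_mul_of_coprime hab
      fun x y => (if n.gcd a ∣ x then c₁ x else 0) * (if n.gcd b ∣ y then c₂ y else 0), ← Finset.sum_mul_sum,
      ← hv₁ _ (Nat.gcd_dvd_right n a), ← hv₂ _ (Nat.gcd_dvd_right n b), ← hmul _ _ (hcop n),
      hfac n hn]

end Mixture

/-! ### The upper bound for the operator norm. -/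

namespace DirichletHilbert

variable {w : ArithmeticFunction ℝ} {hw : ∀ n : ℕ, n ≠ 0 → 0 < w n} {σ₀ δ : ℝ} {φ : ℂ → ℂ}

/-- The decay hypothesis says exactly that `w n * n^(2δ)` does not increase along prime powers. -/
theorem exists_weight_eq_sum_divisors (hw : ∀ n : ℕ, n ≠ 0 → 0 < w n)
    (hmul : w.IsMultiplicative)
    (hdec : ∀ p k : ℕ, p.Prime → 0 < k → w (p ^ k) ≤ w (p ^ (k - 1)) * (p : ℝ) ^ (-2 * δ))
    {J : ℕ} (hJ : J ≠ 0) :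
    ∃ c : ℕ → ℝ, (∀ d, 0 ≤ c d) ∧ ∀ n, n ∣ J →
      w n = (∑ d ∈ J.divisors, if n ∣ d then c d else 0) * (n : ℝ) ^ (-2 * δ) := by
  obtain ⟨c, hc, hv⟩ := exists_sum_divisors_eq (v := fun n => w n * (n : ℝ) ^ (2 * δ))
    (fun n => mul_nonneg (weight_nonneg hw n) (by positivity)) (by simp [hmul.map_one])
    (fun m n hmn => by
      rw [hmul.map_mul_of_coprime hmn]
      push_cast
      rw [Real.mul_rpow (by positivity) (by positivity)]
      ring)
    (fun p k hp => by
      have hp0 : (0 : ℝ) < p := by exact_mod_cast hp.pos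
      have h := hdec p (k + 1) hp k.succ_pos
      rw [Nat.add_sub_cancel] at h
      have hk : (0 : ℝ) ≤ ((p ^ (k + 1) : ℕ) : ℝ) ^ (2 * δ) := by positivity
      refine (mul_le_mul_of_nonneg_right h hk).trans_eq ?_
      push_cast
      rw [pow_succ, Real.mul_rpow (by positivity) hp0.le, mul_assoc,
        mul_left_comm _ _ ((p : ℝ) ^ (2 * δ)), ← Real.rpow_add hp0]
      simp) J hJ
  refine ⟨c, hc, fun n hn => ?_⟩
  have hn0 : (0 : ℝ) < n := by exact_mod_cast Nat.pos_of_dvd_of_pos hn (Nat.pos_of_ne_zero hJ)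
  rw [← hv n hn]
  rw [mul_assoc, ← Real.rpow_add hn0]
  simp

/-- The weighted sum over `J` is a nonnegative combination of sums over the divisors of each `d ∣ J`
with weight `n^(-2δ)`, and the inequality is known for each `d`. -/
theorem sum_divisors_weighted_le (hw : ∀ n : ℕ, n ≠ 0 → 0 < w n) (hmul : w.IsMultiplicative)
    (hdec : ∀ p k : ℕ, p.Prime → 0 < k → w (p ^ k) ≤ w (p ^ (k - 1)) * (p : ℝ) ^ (-2 * δ))
    {ψ : ℂ → ℂ} {C : ℝ} (hψ : DifferentiableOn ℂ ψ (halfPlane δ))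
    (hC : ∀ s ∈ halfPlane δ, ‖ψ s‖ ≤ C) {a g : ArithmeticFunction ℂ}
    (ha : ∀ s ∈ halfPlane σ₀, LSeriesSummable a s)
    (haψ : ∀ s ∈ halfPlane δ ∩ halfPlane σ₀, ψ s = LSeries a s) {J : ℕ} (hJ : J ≠ 0) :
    ∑ n ∈ J.divisors, ‖(a * g) n‖ ^ 2 * w n ≤ C ^ 2 * ∑ n ∈ J.divisors, ‖g n‖ ^ 2 * w n := by
  obtain ⟨c, hc, hcw⟩ := exists_weight_eq_sum_divisors hw hmul hdec hJ
  have key : ∀ h : ArithmeticFunction ℂ, ∑ n ∈ J.divisors, ‖h n‖ ^ 2 * w n =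
      ∑ d ∈ J.divisors, c d * ∑ n ∈ d.divisors, ‖h n‖ ^ 2 * (n : ℝ) ^ (-2 * δ) := by
    intro h
    have e1 : ∀ n ∈ J.divisors, ‖h n‖ ^ 2 * w n = ∑ d ∈ J.divisors,
        if n ∣ d then c d * (‖h n‖ ^ 2 * (n : ℝ) ^ (-2 * δ)) else 0 := by
      intro n hn
      rw [hcw n (Nat.mem_divisors.mp hn).1, Finset.sum_mul, Finset.mul_sum]
      refine Finset.sum_congr rfl fun d _ => ?_
      split_ifs <;> ring
    rw [Finset.sum_congr rfl e1, Finset.sum_comm]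
    refine Finset.sum_congr rfl fun d hd => ?_
    have hdJ := (Nat.mem_divisors.mp hd).1
    have hd0 : d ≠ 0 := (Nat.pos_of_mem_divisors hd).ne'
    rw [← Finset.sum_filter, Finset.mul_sum]
    refine Finset.sum_congr ?_ fun _ _ => rfl
    ext n
    simp only [Nat.mem_divisors, Finset.mem_filter]
    exact ⟨fun h => ⟨h.2, hd0⟩, fun h => ⟨⟨h.1.trans hdJ, hJ⟩, h.1⟩⟩
  rw [key, key, Finset.mul_sum]
  refine Finset.sum_le_sum fun d hd => ?_
  have hd0 : d ≠ 0 := (Nat.pos_of_mem_divisors hd).ne'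
  rw [mul_left_comm]
  exact mul_le_mul_of_nonneg_left (sum_divisors_norm_mul_sq_le hψ hC ha haψ hd0) (hc d)

theorem enorm_le_supOnHalfPlane (hσ₀ : WeightCondition w σ₀) {Φ : DirichletHilbert w hw}
    (hΦ : Φ.Represents φ σ₀) (hmul : w.IsMultiplicative)
    (hdec : ∀ p k : ℕ, p.Prime → 0 < k → w (p ^ k) ≤ w (p ^ (k - 1)) * (p : ℝ) ^ (-2 * δ))
    {M : DirichletHilbert w hw →L[ℂ] DirichletHilbert w hw}
    (hM : IsMultiplicationOperator φ σ₀ M) {ψ : ℂ → ℂ}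
    (hψ : IsAnalyticContinuation φ σ₀ ψ δ) : ‖M‖ₑ ≤ supOnHalfPlane ψ δ := by
  rcases eq_or_ne (supOnHalfPlane ψ δ) ⊤ with htop | htop
  · rw [htop]
    exact le_top
  set C : ℝ := (supOnHalfPlane ψ δ).toReal
  have hC0 : 0 ≤ C := ENNReal.toReal_nonneg
  have hC : ∀ s ∈ halfPlane δ, ‖ψ s‖ ≤ C := fun s hs => by
    rw [← toReal_enorm]
    exact ENNReal.toReal_mono htop (le_iSup₂ (f := fun s (_ : s ∈ halfPlane δ) => ‖ψ s‖ₑ) s hs)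
  have hbound : ∀ f, ‖M f‖ ≤ C * ‖f‖ := by
    intro f
    refine le_of_sq_le_sq ?_ (by positivity)
    rw [mul_pow, norm_sq_eq (M f)]
    refine Real.tsum_le_of_sum_range_le
      (fun n => mul_nonneg (sq_nonneg _) (weight_nonneg hw n)) fun K => ?_
    -- Every positive `n < K` divides `K!`, so sums over divisors of factorials dominate all partial
    -- sums.
    have hsub : ∑ n ∈ Finset.range K, ‖(M f).coeff n‖ ^ 2 * w n ≤
        ∑ n ∈ K.factorial.divisors, ‖(M f).coeff n‖ ^ 2 * w n := by
      rw [← Finset.sum_filter_ne_zero]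
      refine Finset.sum_le_sum_of_subset_of_nonneg (fun n h => ?_)
        fun n _ _ => mul_nonneg (sq_nonneg _) (weight_nonneg hw n)
      obtain ⟨hn, hne⟩ := Finset.mem_filter.mp h
      have hn0 : n ≠ 0 := fun h => hne (by simp [h])
      exact Nat.mem_divisors.mpr ⟨Nat.dvd_factorial (Nat.pos_of_ne_zero hn0)
        (Finset.mem_range.mp hn).le, K.factorial_ne_zero⟩
    refine hsub.trans ?_
    rw [hM.coeff_apply hσ₀ hΦ]
    refine (sum_divisors_weighted_le hw hmul hdec hψ.1 hC (fun s hs => (hΦ s hs).summable)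
      (fun s hs => by rw [hψ.2 s hs, (hΦ s hs.2).LSeries_eq]) K.factorial_ne_zero).trans ?_
    refine mul_le_mul_of_nonneg_left ?_ (sq_nonneg C)
    rw [norm_sq_eq]
    exact f.coeff_summable.sum_le_tsum _
      fun n _ => mul_nonneg (sq_nonneg _) (weight_nonneg hw n)
  have hle := M.opNorm_le_bound hC0 hbound
  rw [← ENNReal.ofReal_toReal htop, ← ofReal_norm]
  exact ENNReal.ofReal_le_ofReal hle

end DirichletHilbert

/-! ### Assembly of the theorem. -/

theorem mainTheorem1 (w : ArithmeticFunction ℝ) (hw : ∀ n : ℕ, n ≠ 0 → 0 < w n)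
    (σ₀ : ℝ) (hσ₀ : WeightCondition w σ₀)
    (φ : ℂ → ℂ) (hφ : IsMultiplier w hw φ σ₀) :
    -- `φ` has a Dirichlet series in `𝓗^w`, and `M_φ` is a bounded operator
    (∃! Φ : DirichletHilbert w hw, Φ.Represents φ σ₀) ∧
    (∃! M : DirichletHilbert w hw →L[ℂ] DirichletHilbert w hw,
      IsMultiplicationOperator φ σ₀ M) ∧
    -- the lower bound
    (∀ Δ Δ' : ℝ, 0 ≤ Δ → Δ ≤ Δ' → WeightCondition w Δ' → ProjectedWeightCondition w Δ →
      (∀ f : DirichletHilbert w hw, f.AbsConvergesOn Δ') ∧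
      (∀ N : ℕ, ∀ f ∈ projSubspace w hw N, f.AbsConvergesOn Δ) ∧
      (∃ R : RKHS ℂ (DirichletHilbert w hw) (halfPlane Δ') ℂ,
        ∀ (f : DirichletHilbert w hw) (s : halfPlane Δ'), R.coeCLM f s = f.eval s) ∧
      (∀ (Φ : DirichletHilbert w hw) (M : DirichletHilbert w hw →L[ℂ] DirichletHilbert w hw),
        Φ.Represents φ σ₀ → IsMultiplicationOperator φ σ₀ M →
        (∀ N : ℕ, supOnHalfPlane (proj w hw N Φ).eval Δ ≤ ‖M‖ₑ) ∧
        (∃ ψ : ℂ → ℂ, IsAnalyticContinuation φ σ₀ ψ Δ ∧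
          (∀ s ∈ halfPlane Δ, DirichletConvergesTo Φ.coeff s (ψ s)) ∧
          supOnHalfPlane ψ Δ ≤ ‖M‖ₑ))) ∧
    -- the upper bound
    (∀ δ : ℝ, 0 ≤ δ → w.IsMultiplicative →
      (∀ p k : ℕ, p.Prime → 0 < k → w (p ^ k) ≤ w (p ^ (k - 1)) * (p : ℝ) ^ (-2 * δ)) →
      ∀ M : DirichletHilbert w hw →L[ℂ] DirichletHilbert w hw,
        IsMultiplicationOperator φ σ₀ M →
        ∀ ψ : ℂ → ℂ, IsAnalyticContinuation φ σ₀ ψ δ → ‖M‖ₑ ≤ supOnHalfPlane ψ δ) := by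
  obtain ⟨Φ₀, hΦ₀⟩ := DirichletHilbert.exists_represents hφ
  obtain ⟨M₀, hM₀⟩ := DirichletHilbert.exists_isMultiplicationOperator hσ₀ hφ
  refine ⟨⟨Φ₀, hΦ₀, fun Φ hΦ => hΦ.unique hσ₀ hΦ₀⟩, ⟨M₀, hM₀, fun M hM => hM.unique hσ₀ hM₀⟩,
    fun Δ Δ' _ _ hΔ' hΔ => ⟨DirichletHilbert.absConvergesOn hΔ',
      fun N f hf => DirichletHilbert.absConvergesOn_of_mem_projSubspace hΔ hf,
      ⟨DirichletHilbert.rkhs hΔ', fun f s => rfl⟩, fun Φ M hΦ hM =>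
        ⟨DirichletHilbert.supOnHalfPlane_proj_le hσ₀ hΔ hΦ hM,
          DirichletHilbert.exists_analyticContinuation hσ₀ hΔ hΦ hM⟩⟩,
    fun δ _ hmul hdec M hM ψ hψ =>
      DirichletHilbert.enorm_le_supOnHalfPlane hσ₀ hΦ₀ hmul hdec hM hψ⟩
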